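/- Let $\mathbb{D}=\{z\in\mathbb{C}:|z|<1\}$ and let $\mathcal{F}_1$ be the class of analytic functions $f$ on $\mathbb{D}$ with $f(0)=0$, $f'(0)=1$ and $\operatorname{Re}\big((1-z)f'(z)\big)>0$ for all $z\in\mathbb{D}$. The logarithmic coefficients $\gamma_n=\gamma_n(f)$ are defined by the Taylor expansion at $0$ $$\log\frac{f(z)}{z}=2\sum_{n=1}^{\infty}\gamma_n z^n ,\qquad \log 1:=0,$$ and $H_{2,1}(F_f)=\begin{vmatrix}\gamma_1&\gamma_2\\ \gamma_2&\gamma_3\end{vmatrix}=\gamma_1\gamma_3-\gamma_2^2$. Let $X(x)=-48x^4-96x^3-392x^2+24x+357$. Then the equation $X'(x)=0$ has exactly one real root $\eta$; it satisfies $0.0302<\eta<0.0303$ and $|2\eta-0.0605378|<5\cdot 10^{-8}$. For every $f\in\mathcal{F}_1$, $$|\gamma_1\gamma_3-\gamma_2^2|\le \frac{X(\eta)}{2304}.$$ The bound is sharp: the function $$p_1(z)=\frac{1+2\eta z+z^2}{1-z^2}$$ is a Carathéodory function (analytic on $\mathbb{D}$, $p_1(0)=1$, $\operatorname{Re}p_1>0$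 on $\mathbb{D}$), the function $$\tilde f(z)=\int_0^z\frac{p_1(t)}{1-t}\,dt\qquad(z\in\mathbb{D})$$ belongs to $\mathcal{F}_1$, and $|\gamma_1\gamma_3-\gamma_2^2|=X(\eta)/2304$ for $f=\tilde f$. -/

import Mathlib

/-- The class of functions `f` analytic on the open unit disc with `f 0 = 0` and `f' 0 = 1`. -/
def ClassA (f : ℂ → ℂ) : Prop :=
  AnalyticOnNhd ℂ f (Metric.ball 0 1) ∧ f 0 = 0 ∧ deriv f 0 = 1

/-- The class of normalised analytic `f` with `Re ((1 - z) f'(z)) > 0` on the open unit disc. -/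
def ClassF1 (f : ℂ → ℂ) : Prop :=
  ClassA f ∧ ∀ z ∈ Metric.ball (0 : ℂ) 1, 0 < ((1 - z) * deriv f z).re

/-- The Carathéodory class: `p` analytic on the open unit disc, `p 0 = 1`, `Re p > 0`. -/
def Caratheodory (p : ℂ → ℂ) : Prop :=
  AnalyticOnNhd ℂ p (Metric.ball 0 1) ∧ p 0 = 1 ∧ ∀ z ∈ Metric.ball (0 : ℂ) 1, 0 < (p z).re

/-- The logarithmic coefficients: `log (f z / z) = 2 * ∑ γ n * z ^ n`, `log 1 = 0`, so that
`γ n` is half the `n`-th Taylor coefficient at `0` of `log (f z / z)`. Here `dslope f 0 z` is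
`f z / z` for `z ≠ 0` (when `f 0 = 0`) and `f' 0` for `z = 0`; for normalised analytic `f` it is
analytic at `0` with value `1` there, so the principal logarithm is the required branch near `0`. -/
noncomputable def logCoeff (f : ℂ → ℂ) (n : ℕ) : ℂ :=
  iteratedDeriv n (fun z => Complex.log (dslope f 0 z)) 0 / (n.factorial : ℂ) / 2

/-- The Hankel determinant `H_{q,n}` with entries the logarithmic coefficients of `f`. -/
noncomputable def logHankel (q n : ℕ) (f : ℂ → ℂ) : ℂ :=
  Matrix.det (Matrix.of fun i j : Fin q => logCoeff f (n + (i : ℕ) + (j : ℕ)))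

/-- The quartic polynomial function `X`. -/
noncomputable def quarticX (x : ℝ) : ℝ :=
  -48 * x ^ 4 - 96 * x ^ 3 - 392 * x ^ 2 + 24 * x + 357

/-- The function `p₁`, with `2 η` as its middle coefficient. -/
noncomputable def pOne (η : ℝ) (z : ℂ) : ℂ :=
  (1 + 2 * (η : ℂ) * z + z ^ 2) / (1 - z ^ 2)

/-- `∫₀^z p₁(t) / (1 - t) dt`, taken along the segment `t = s z`, `0 ≤ s ≤ 1`. -/
noncomputable def extremalF1 (η : ℝ) (z : ℂ) : ℂ :=
  ∫ s in (0 : ℝ)..1, pOne η ((s : ℂ) * z) / (1 - (s : ℂ) * z) * z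

/-!
Put `p z = (1 - z) f' z`, a Carathéodory function, with coefficients `c₁`, `c₂`, `c₃`. Comparing
Taylor coefficients (`taylorCoeff_log`, `logHankel_eq`) gives, for `H = γ₁ γ₃ - γ₂ ^ 2`,
`2304 H = 72 (1 + c₁) (1 + c₁ + c₂ + c₃) - 64 (1 + c₁ + c₂) ^ 2 + 3 (1 + c₁) ^ 4`.
Writing `p = (1 + z φ) / (1 - z φ)` with `φ` in the Schur class and running two steps of the Schur
algorithm on `φ` (`SchurClass.exists_parameters`) turns this into
`2304 H = C(a) - r β(a) b - r α(a) b ^ 2 + 144 r (1 + 2 a) (1 - |b|²) ζ`, with `r = 1 - |a|²` and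
parameters `a`, `b`, `ζ` in the closed unit disc. The class is not invariant under rotations, so `a`
has to be taken complex. It remains to bound
`|C - r β b - r α b ^ 2| + 144 r |1 + 2 a| (1 - |b|²)` by `X(η)` on the closed bidisc
(`norm_trinomial_add_le`).

Outside a rectangle in `x = Re a`, `y = Im a` the triangle inequality is enough (`outerBound_le`).
Inside it, homogenize: `|C w ^ 2 - r β z w - r α z ^ 2| ≤ m₁ |z|² + m₂ |w|²` holds with
`m₁ + m₂ = X(η)` once a real quadratic form in the four variables `Re z`, `Re z - Re w`, `Im z`,
`Im w` is positive semidefinite (`norm_trinomial_le`), and `m₁ ≥ 144 r |1 + 2 a|` then absorbs the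
last term. The split of `X(η)` into `m₁` and `m₂` is governed by a parameter `δ(x, y ^ 2)`. Positive
semidefiniteness is reduced by completing squares (`quadForm_nonneg`) to the nonnegativity of
polynomials in `x` and `y ^ 2` on rectangles, which their Bernstein coefficients show
(`nonneg_of_mul_eq_bernTable`). For real `a = x` and `b = 1` the trinomial equals `-X(x)`, so there
is no slack at `x = η` and `δ` has to vanish there; near `η` the exact expansion of `X` at its
critical point replaces a numerical bound (`quarticX_gap`).

The extremal function corresponds to `a = η`, `b = 1`: from `p₁ (1 - z ^ 2) = 1 + 2 η z + z ^ 2` its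
coefficients are `c₁ = 2 η`, `c₂ = 2`, `c₃ = 2 η`, and `2304 H = -X(η)`.
-/

/-! ### Bernstein forms -/

/-- The homogeneous form `∑ cᵢ * a ^ i * b ^ (n - i)` with coefficient list `c₀, …, cₙ`. -/
def bernForm : List ℝ → ℝ → ℝ → ℝ
  | [], _, _ => 0
  | c :: cs, a, b => c * b ^ cs.length + a * bernForm cs a b

theorem bernForm_nonneg {a b : ℝ} (ha : 0 ≤ a) (hb : 0 ≤ b) :
    ∀ cs : List ℝ, (∀ c ∈ cs, 0 ≤ c) → 0 ≤ bernForm cs a b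
  | [], _ => le_rfl
  | c :: cs, h => by
    have h0 := h c (by simp)
    have h1 := bernForm_nonneg ha hb cs fun d hd => h d (by simp [hd])
    simp only [bernForm]
    positivity

/-- The tensor Bernstein form with a table of natural numbers: the rows are forms in `t` and
`1 - t`, and they are the coefficients of a form in `s` and `1 - s`. -/
def bernTable (rows : List (List ℕ)) (s t : ℝ) : ℝ :=
  bernForm (rows.map fun r => bernForm (r.map fun n : ℕ => (n : ℝ)) t (1 - t)) s (1 - s)

theorem bernTable_nonneg (rows : List (List ℕ)) {s t : ℝ} (hs : 0 ≤ s) (hs1 : s ≤ 1)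
    (ht : 0 ≤ t) (ht1 : t ≤ 1) : 0 ≤ bernTable rows s t := by
  refine bernForm_nonneg hs (by linarith) _ fun c hc => ?_
  obtain ⟨r, -, rfl⟩ := List.mem_map.1 hc
  refine bernForm_nonneg ht (by linarith) _ fun d hd => ?_
  obtain ⟨n, -, rfl⟩ := List.mem_map.1 hd
  positivity

/-- The shape in which the polynomial inequalities below are certified: an identity with a table of
nonnegative Bernstein coefficients, after clearing denominators. -/
theorem nonneg_of_mul_eq_bernTable {K E s t : ℝ} (hK : 0 < K) (hs : 0 ≤ s) (hs1 : s ≤ 1)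
    (ht : 0 ≤ t) (ht1 : t ≤ 1) (rows : List (List ℕ)) (h : K * E = bernTable rows s t) :
    0 ≤ E :=
  nonneg_of_mul_nonneg_right (h ▸ bernTable_nonneg rows hs hs1 ht ht1) hK

/-- An affine parametrization of `[a, b]` by `[0, 1]`. -/
theorem exists_eq_add_mul {a b x : ℝ} (hab : a < b) (h₁ : a ≤ x) (h₂ : x ≤ b) :
    ∃ s : ℝ, 0 ≤ s ∧ s ≤ 1 ∧ x = a + (b - a) * s := by
  have hw : 0 < b - a := sub_pos.2 hab
  refine ⟨(x - a) / (b - a), div_nonneg (by linarith) hw.le, (div_le_one hw).2 (by linarith), ?_⟩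
  rw [mul_div_cancel₀ _ hw.ne']
  ring

/-! ### A positive semidefinite quadratic form -/

/-- A sufficient condition for a quadratic form in `(p, e, u, v)` to be positive semidefinite. With
`u = μ p + U` and `v = l p + V` the form is the sum of `(A - A₁ - A₂) u ^ 2`, of a nonnegative
multiple of `p ^ 2` (by `hV`), of a binary form in `(e, V)` (nonnegative by `hE` and `hdet`), and of
four squares, one for each of the weights `E₁`, `A₁`, `D₁`, `A₂`, that absorb the mixed terms. -/
theorem quadForm_nonneg {Δ δ E A B D P Q S T μ l E₁ A₁ D₁ A₂ : ℝ}
    (hE₁ : 0 < E₁) (hA₁ : 0 < A₁) (hD₁ : 0 < D₁) (hA₂ : 0 < A₂) (hA : A₁ + A₂ ≤ A)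
    (hE : 0 < E - E₁ - S ^ 2 / A₂)
    (hdet : (T - S * B / A₂) ^ 2 ≤ (E - E₁ - S ^ 2 / A₂) * (D - D₁ - B ^ 2 / A₂))
    (hV : (S * μ + T * l - δ) ^ 2 / E₁ + ((A₁ + A₂) * μ + B * l + P) ^ 2 / A₁
        + (B * μ + D * l + Q) ^ 2 / D₁
      ≤ Δ + ((A₁ + A₂) * μ ^ 2 + 2 * B * μ * l + D * l ^ 2) + 2 * (P * μ + Q * l))
    (p e u v : ℝ) :
    0 ≤ Δ * p ^ 2 - 2 * δ * p * e + E * e ^ 2 + A * u ^ 2 + 2 * B * u * v + D * v ^ 2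
      + 2 * P * p * u + 2 * Q * p * v + 2 * S * e * u + 2 * T * e * v := by
  set E' := E - E₁ - S ^ 2 / A₂ with hE'
  set D' := D - D₁ - B ^ 2 / A₂ with hD'
  set W := T - S * B / A₂ with hW
  set U := u - μ * p with hU_def
  set V := v - l * p with hV_def
  have h1 : 0 ≤ E' * e ^ 2 + 2 * W * e * V + D' * V ^ 2 := by
    have h2 : E' * (E' * e ^ 2 + 2 * W * e * V + D' * V ^ 2)
        = (E' * e + W * V) ^ 2 + (E' * D' - W ^ 2) * V ^ 2 := by ring
    have h3 : 0 ≤ E' * (E' * e ^ 2 + 2 * W * e * V + D' * V ^ 2) := by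
      rw [h2]
      have := mul_nonneg (sub_nonneg.2 hdet) (sq_nonneg V)
      positivity
    exact nonneg_of_mul_nonneg_right h3 hE
  have h4 := mul_nonneg (sub_nonneg.2 hA) (sq_nonneg u)
  have h5 := mul_nonneg (sub_nonneg.2 hV) (sq_nonneg p)
  have h6 : 0 ≤ E₁ * (e + (S * μ + T * l - δ) * p / E₁) ^ 2 := by positivity
  have h7 : 0 ≤ A₁ * (U + ((A₁ + A₂) * μ + B * l + P) * p / A₁) ^ 2 := by positivity
  have h8 : 0 ≤ D₁ * (V + (B * μ + D * l + Q) * p / D₁) ^ 2 := by positivity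
  have h9 : 0 ≤ A₂ * (U + (B * V + S * e) / A₂) ^ 2 := by positivity
  refine (add_nonneg (add_nonneg (add_nonneg (add_nonneg (add_nonneg (add_nonneg h1 h4) h5) h6)
    h7) h8) h9).trans_eq ?_
  rw [hE', hD', hW, hU_def, hV_def]
  field_simp
  ring

/-! ### The quadratic majorant form -/

/-- `1 - |a|²` for `a = x + iy`, `t = y²`. -/
def defect (x t : ℝ) : ℝ := 1 - (x ^ 2 + t)

/-- The real part of `α(a) = 256 + 144 ā + 32 |a|²` for `a = x + iy`, `t = y²`. -/
def alphaRe (x t : ℝ) : ℝ := 256 + 144 * x + 32 * (x ^ 2 + t)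

/-- The real part of `β(a) = 112 - 64 a - 64 a²` for `a = x + iy`, `t = y²`. -/
def betaRe (x t : ℝ) : ℝ := 112 - 64 * x - 64 * (x ^ 2 - t)

/-- The real part of `C(a) = 11 + 56 a - 8 a² + 16 a³ + 80 a⁴` for `a = x + iy`, `t = y²`. -/
def constRe (x t : ℝ) : ℝ :=
  11 + 56 * x - 8 * (x ^ 2 - t) + 16 * (x ^ 3 - 3 * x * t)
    + 80 * (x ^ 4 - 6 * x ^ 2 * t + t ^ 2)

/-- The imaginary part of `C(a)` divided by `y`, for `a = x + iy`, `t = y²`. -/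
def constIm (x t : ℝ) : ℝ :=
  56 - 16 * x + 16 * (3 * x ^ 2 - t) + 80 * (4 * x ^ 3 - 4 * x * t)

/-- `Re (r α + r β - C)`, where `r = 1 - |a|²`. -/
def topRe (x t : ℝ) : ℝ := defect x t * (alphaRe x t + betaRe x t) - constRe x t

/-- Half of `Re (r β)`. -/
noncomputable def halfBeta (x t : ℝ) : ℝ := defect x t * betaRe x t / 2

/-- `- Im (r β) / (2 y)`. -/
def betaIm (x t : ℝ) : ℝ := defect x t * (32 + 64 * x)

/-- `Im (r α + r β / 2) / y`. -/
def mixIm (x t : ℝ) : ℝ := -(defect x t * (176 + 64 * x))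

/-- The first slack of `form_nonneg_of_slack`: the coefficient of `e²` left over. -/
noncomputable def slackE (δ E₁ A₂ x t : ℝ) : ℝ :=
  halfBeta x t + δ - E₁ - betaIm x t ^ 2 * t / A₂

/-- The determinant of the form in `(e, V)` left over in `form_nonneg_of_slack`. -/
noncomputable def slackDet (δ E₁ D₁ A₂ x t : ℝ) : ℝ :=
  slackE δ E₁ A₂ x t
      * (halfBeta x t - 2 * constRe x t + δ - D₁ - halfBeta x t ^ 2 / A₂)
    - (constIm x t - betaIm x t * halfBeta x t / A₂) ^ 2 * t

/-- The coefficient of `p²` left over in `form_nonneg_of_slack`. -/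
noncomputable def slackP (M δ μ l E₁ A₁ D₁ A₂ x t : ℝ) : ℝ :=
  M - topRe x t
    + ((A₁ + A₂) * μ ^ 2 + 2 * halfBeta x t * μ * l
      + (halfBeta x t - 2 * constRe x t + δ) * l ^ 2
      + 2 * (mixIm x t * μ - (betaIm x t + constIm x t) * l)) * t
    - ((betaIm x t * μ + constIm x t * l) * t - δ) ^ 2 / E₁
    - ((A₁ + A₂) * μ + halfBeta x t * l + mixIm x t) ^ 2 * t / A₁
    - (halfBeta x t * μ + (halfBeta x t - 2 * constRe x t + δ) * l
      - (betaIm x t + constIm x t)) ^ 2 * t / D₁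

/-- The coefficient of `u²`, minus the part `A₁ + A₂` of it that is used. -/
noncomputable def slackA (M δ A₁ A₂ x t : ℝ) : ℝ :=
  2 * (defect x t * alphaRe x t) + halfBeta x t + (M - topRe x t - δ) - (A₁ + A₂)

/-- The quadratic form `m₁ |z|² + m₂ |w|² - Re (r α z² + r β z w - C w²)` in the variables
`p = Re z`, `e = Re z - Re w`, `u = Im z`, `v = Im w`, for `a = x + iy`, where `m₁ + m₂ = M` and
`m₂ = Re (r β / 2 - C) + δ`. -/
noncomputable def majorantForm (M δ x y p e u v : ℝ) : ℝ :=
  (M - topRe x (y ^ 2)) * p ^ 2 - 2 * δ * p * e + (halfBeta x (y ^ 2) + δ) * e ^ 2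
    + (2 * (defect x (y ^ 2) * alphaRe x (y ^ 2)) + halfBeta x (y ^ 2)
      + (M - topRe x (y ^ 2) - δ)) * u ^ 2
    + 2 * halfBeta x (y ^ 2) * u * v
    + (halfBeta x (y ^ 2) - 2 * constRe x (y ^ 2) + δ) * v ^ 2
    + 2 * (y * mixIm x (y ^ 2)) * p * u
    - 2 * (y * (betaIm x (y ^ 2) + constIm x (y ^ 2))) * p * v
    + 2 * (y * betaIm x (y ^ 2)) * e * u + 2 * (y * constIm x (y ^ 2)) * e * v

/-- The four slacks are polynomials in `x` and `t = y ^ 2` only: the odd entries of the form carry a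
factor `y`, and so do the shifts `y * μ` and `y * l`. -/
theorem form_nonneg_of_slack {M δ μ l E₁ A₁ D₁ A₂ x y : ℝ}
    (hE₁ : 0 < E₁) (hA₁ : 0 < A₁) (hD₁ : 0 < D₁) (hA₂ : 0 < A₂)
    (hA : 0 ≤ slackA M δ A₁ A₂ x (y ^ 2)) (hE : 0 < slackE δ E₁ A₂ x (y ^ 2))
    (hdet : 0 ≤ slackDet δ E₁ D₁ A₂ x (y ^ 2))
    (hP : 0 ≤ slackP M δ μ l E₁ A₁ D₁ A₂ x (y ^ 2)) (p e u v : ℝ) :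
    0 ≤ majorantForm M δ x y p e u v := by
  unfold slackA at hA
  unfold slackDet at hdet
  unfold slackE at hE hdet
  unfold slackP at hP
  have h := quadForm_nonneg (Δ := M - topRe x (y ^ 2)) (δ := δ) (E := halfBeta x (y ^ 2) + δ)
    (A := 2 * (defect x (y ^ 2) * alphaRe x (y ^ 2)) + halfBeta x (y ^ 2)
      + (M - topRe x (y ^ 2) - δ)) (B := halfBeta x (y ^ 2))
    (D := halfBeta x (y ^ 2) - 2 * constRe x (y ^ 2) + δ) (P := y * mixIm x (y ^ 2))
    (Q := -(y * (betaIm x (y ^ 2) + constIm x (y ^ 2)))) (S := y * betaIm x (y ^ 2))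
    (T := y * constIm x (y ^ 2)) (μ := y * μ) (l := y * l) hE₁ hA₁ hD₁ hA₂ (by linarith)
    (by linear_combination hE) (by linear_combination hdet) (by linear_combination hP) p e u v
  unfold majorantForm
  linarith

/-! ### Certificates for `-0.15 ≤ Re a ≤ 0.06` -/

/-- The parameter `δ` for `x` near the maximum point. It has to vanish at the extremal configuration
`x = η`, `t = 0`, hence the multiple of the derivative of `X`. -/
noncomputable def deltaCentral (x t : ℝ) : ℝ :=
  -(23 / 200) * (24 - 784 * x - 288 * x ^ 2 - 192 * x ^ 3) + 141 * t

theorem central_slackA {x t : ℝ} (hx₀ : -3 / 20 ≤ x) (hx₁ : x ≤ 3 / 50)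
    (ht₀ : 0 ≤ t) (ht₁ : t ≤ 23 / 100) :
    0 ≤ slackA (178682299 / 500000) (deltaCentral x t) 200 250 x t := by
  obtain ⟨s, hs₀, hs₁, rfl⟩ := exists_eq_add_mul (by norm_num) hx₀ hx₁
  obtain ⟨τ, hτ₀, hτ₁, rfl⟩ := exists_eq_add_mul (by norm_num) ht₀ ht₁
  refine nonneg_of_mul_eq_bernTable (K := 12500000) (by norm_num) hs₀ hs₁ hτ₀ hτ₁
    [[1206075225, 1516185450, 363010225], [5303283600, 6985999200, 1894315600], [8622119970,
     11689353540, 3384633570], [6136500684, 8441072568, 2516171884], [1611978051, 2222310702,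
     663232651]] ?_
  simp only [defect, alphaRe, betaRe, constRe, topRe, halfBeta, slackA, deltaCentral,
    bernTable, bernForm, List.map_cons, List.map_nil, List.length_cons, List.length_nil,
    Nat.reduceAdd, Nat.cast_ofNat]
  ring

/-- The subtracted `1` gives the strict positivity that the division by the slack needs. -/
theorem central_slackE {x t : ℝ} (hx₀ : -3 / 20 ≤ x) (hx₁ : x ≤ 3 / 50)
    (ht₀ : 0 ≤ t) (ht₁ : t ≤ 23 / 100) :
    0 ≤ slackE (deltaCentral x t) 32 250 x t - 1 := by
  obtain ⟨s, hs₀, hs₁, rfl⟩ := exists_eq_add_mul (by norm_num) hx₀ hx₁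
  obtain ⟨τ, hτ₀, hτ₁, rfl⟩ := exists_eq_add_mul (by norm_num) ht₀ ht₁
  refine nonneg_of_mul_eq_bernTable (K := 6103515625000) (by norm_num) hs₀ hs₁ hτ₀ hτ₁
    [[61736328125000, 340024169734375, 485774212718750, 207337325359375], [470191552734375,
     2345321780090625, 3227279965528125, 1351076608771875], [1404753457031250, 6564614338800000,
     8787497665451250, 3624453166462500], [2153796443359375, 9611806494093125, 12598888418336125,
     5135894277722375], [1809119039062500, 7801824971466750, 10059178147795200, 4062126041320950],
     [795322781250000, 3340222994464020, 4249925272372440, 1703021884278420], [143701953125000,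
     590885816025862, 743639685029924, 296074265009062]] ?_
  simp only [defect, betaRe, halfBeta, betaIm, slackE, deltaCentral,
    bernTable, bernForm, List.map_cons, List.map_nil, List.length_cons, List.length_nil,
    Nat.reduceAdd, Nat.cast_ofNat]
  ring

/-- The weight of `|b|²` in the majorant dominates the contribution of the third Schur parameter, as
`|1 + 2 a| ≤ 5 / 4 + Re a + |a|²`. -/
theorem central_weight {x t : ℝ} (hx₀ : -3 / 20 ≤ x) (hx₁ : x ≤ 3 / 50)
    (ht₀ : 0 ≤ t) (ht₁ : t ≤ 23 / 100) :
    0 ≤ (178682299 / 500000) - halfBeta x t + constRe x t - deltaCentral x t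
      - 144 * (defect x t * (5 / 4 + x + (x ^ 2 + t))) := by
  obtain ⟨s, hs₀, hs₁, rfl⟩ := exists_eq_add_mul (by norm_num) hx₀ hx₁
  obtain ⟨τ, hτ₀, hτ₁, rfl⟩ := exists_eq_add_mul (by norm_num) ht₀ ht₁
  refine nonneg_of_mul_eq_bernTable (K := 12500000) (by norm_num) hs₀ hs₁ hτ₀ hτ₁
    [[1983163975, 3716432950, 1902548975], [7495681600, 14065199200, 7246637600], [10621762170,
     19940059140, 10333976970], [6688061164, 12548103928, 6537162764], [1583484163, 2966146126,
     1551941963]] ?_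
  simp only [defect, betaRe, constRe, halfBeta, deltaCentral,
    bernTable, bernForm, List.map_cons, List.map_nil, List.length_cons, List.length_nil,
    Nat.reduceAdd, Nat.cast_ofNat]
  ring

theorem central_slackDet {x t : ℝ} (hx₀ : -3 / 20 ≤ x) (hx₁ : x ≤ 3 / 50)
    (ht₀ : 0 ≤ t) (ht₁ : t ≤ 23 / 100) :
    0 ≤ slackDet (deltaCentral x t) 32 16 250 x t := by
  obtain ⟨s, hs₀, hs₁, rfl⟩ := exists_eq_add_mul (by norm_num) hx₀ hx₁
  obtain ⟨τ, hτ₀, hτ₁, rfl⟩ := exists_eq_add_mul (by norm_num) ht₀ ht₁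
  refine nonneg_of_mul_eq_bernTable (K := 7629394531250000000000) (by norm_num) hs₀ hs₁ hτ₀ hτ₁
    [[721296462295057031250000, 3277522992393989941406250, 8157318983365380957031250,
     11971322713780736914062500, 9016705479161818945312500, 2690577734080968457031250,
     44250551322438378906250], [9055024745113923720703125, 43884533837332021933593750,
     115017857380870947919921875, 175163632434795196757812500, 139474091806168158779296875,
     48457050797680851621093750, 3960019568323039892578125], [50737611887927001679687500,
     258327863781970816570312500, 707194348714022543531250000, 1113363787982229294515625000,
     924911445257706345867187500, 351412350857329479539062500, 40270367130547699546875000],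
     [168212602026646508296875000, 892696420589433863971875000, 2547726055349500252531250000,
     4145382066635686310843750000, 3572402691731660398209375000, 1445753559597056303934375000,
     195523265609949319712500000], [367839227164119055143750000, 2028311430376966714373906250,
     6045920917381906469332031250, 10182884767560322279214062500, 9080097517525160898632812500,
     3861606033708473370944531250, 579017847339630941423906250], [558611807202386316004500000,
     3202304223394873941095250000, 10016503570266151987100250000, 17509471578287365546246500000,
     16137996397730903743623000000, 7155199640852778387458250000, 1153980911759663828072250000],
     [602699110525715937687450000, 3607333689228823681517250000, 11928898616030779017469800000,
     21715404026547860448071700000, 20679289209756315409657050000, 9509195281143458263516650000,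
     1621182845768768028291300000], [463278809294317522396800000, 2921067908231433237805320000,
     10320222965742727696837440000, 19640285685342706294060560000, 19322412932612682774858240000,
     9180659410004238040238760000, 1636215540352737578012160000], [249580297463652507623040000,
     1684600594846077364768728000, 6451483434511390403442840000, 12889875203250627804599880000,
     13100288786685290642084280000, 6412277745775937281034880000, 1185474302977363897253328000],
     [90359778470421393261888000, 672140700997941410210251200, 2846619805029546877939736000,
     5998018940784354436874192000, 6296394526284822289058352000, 3167069803496698987773144000,
     603887903389784274597611200], [20130510054648595014389760, 174811039646480434766184960,
     842489931385829180417078400, 1881008150500066109562259200, 2038890263030550425230310400,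
     1051563355974125289697570560, 205881612018317633364236160], [2247644056135801964261376,
     26238084966502467746643456, 150273785004293399231696640, 357288311253919629161579520,
     399703727388411360497072640, 210954550936856003488544256, 42257567139105538703736576],
     [57612229307483954073600, 1669731100668975756825600, 12219471655460753739464000,
     31102956036824190839072000, 35890439710125771937584000, 19348670447768956256121600,
     3953982026257113220897600]] ?_
  simp only [defect, betaRe, constRe, constIm, halfBeta, betaIm, slackE, slackDet, deltaCentral,
    bernTable, bernForm, List.map_cons, List.map_nil, List.length_cons, List.length_nil,
    Nat.reduceAdd, Nat.cast_ofNat]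
  ring

theorem central_right_slackP_low {x t : ℝ} (hx₀ : 9 / 250 ≤ x) (hx₁ : x ≤ 3 / 50)
    (ht₀ : 0 ≤ t) (ht₁ : t ≤ 3 / 100) :
    0 ≤ slackP (178682299 / 500000)
      (deltaCentral x t) (18 / 125) (247 / 100) 32 200 16 250 x t := by
  obtain ⟨s, hs₀, hs₁, rfl⟩ := exists_eq_add_mul (by norm_num) hx₀ hx₁
  obtain ⟨τ, hτ₀, hτ₁, rfl⟩ := exists_eq_add_mul (by norm_num) ht₀ ht₁
  refine nonneg_of_mul_eq_bernTable (K := 381469726562500000000000000) (by norm_num) hs₀ hs₁ hτ₀ hτ₁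
    [[1686460192806995000000000, 59725682488390252246401856, 746371440515224586215177424,
     1811918001755138173100324261, 1621134391829057949665723674, 497415474806197824284174981],
     [27586029675656440000000000, 320124367931351402871610880, 5296273589260336986746283520,
     13546585685061869528124810280, 12394818601410639819997213520, 3850903099454506065747075880],
     [175199013351600020000000000, 691184421558451066583084800, 16379098614209728012312059200,
     44259621458685672292767356300, 41439632264199629089930874200, 13039396273870661887892492300],
     [565784113744796200000000000, 765766638704750004642176000, 28842022034364118407816904000,
     82538672716721384016807031000, 79125934275194905891232054000, 25221845592585342727599751000],
     [1048379104417711250000000000, 484534102016741950313200000, 31647014410007520815795300000,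
     96095081753949002335730918750, 94374331396858796431578737500, 30480789711202854523829918750],
     [1168586130577525000000000000, 244442144772768563633600000, 22177029779205457949184400000,
     71522932011805474006360975000, 71995499435124792357203150000, 23566285713037188986392975000],
     [777425439079812500000000000, 166314478734800748508000000, 9706088967872293882907000000,
     33235306028218510525602687500, 34304796306519239146516375000, 11382962468871862380312687500],
     [285271889296375000000000000, 92647150932381997280000000, 2430684148893510261745000000,
     8815752420928739630070625000, 9333887027078516151526250000, 3140378425508373535920625000],
     [44538146252421875000000000, 21221617535186507725000000, 267436119087930536056250000,
     1022015591863055195851953125, 1110244979371405830060156250, 378848901826153256289453125]] ?_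
  simp only [defect, alphaRe, betaRe, constRe, constIm, topRe, halfBeta, betaIm, mixIm,
    slackP, deltaCentral,
    bernTable, bernForm, List.map_cons, List.map_nil, List.length_cons, List.length_nil,
    Nat.reduceAdd, Nat.cast_ofNat]
  ring

theorem central_right_slackP_high {x t : ℝ} (hx₀ : 9 / 250 ≤ x) (hx₁ : x ≤ 3 / 50)
    (ht₀ : 3 / 100 ≤ t) (ht₁ : t ≤ 23 / 100) :
    0 ≤ slackP (178682299 / 500000)
      (deltaCentral x t) (18 / 125) (247 / 100) 32 200 16 250 x t := by
  obtain ⟨s, hs₀, hs₁, rfl⟩ := exists_eq_add_mul (by norm_num) hx₀ hx₁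
  obtain ⟨τ, hτ₀, hτ₁, rfl⟩ := exists_eq_add_mul (by norm_num) ht₀ ht₁
  refine nonneg_of_mul_eq_bernTable (K := 381469726562500000000000000) (by norm_num) hs₀ hs₁ hτ₀ hτ₁
    [[497415474806197824284174981, 8260030588710530266455216445, 41467531273486125813164865970,
     61070183358574352730480049050, 38713758002168959965865491065, 9595292615676400606379266521],
     [3850903099454506065747075880, 64985828136351800386989818600, 331493938171500847806342515600,
     490069314322490382529559394000, 310445040761342892859315136200, 76709154073456063814855515080],
     [13039396273870661887892492300, 223579308737044511769673043500,
     1159259056235861419842824251000, 1720305624314729942701859415000,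
     1088850890045500363514475789500, 268174860253457990773660074300],
     [25221845592585342727599751000, 439331185881138765283110095000,
     2316368133900709977317612870000, 3450327265447528714555175550000,
     2181741609767405844651954115000, 535494039432033684858881091000],
     [30480789711202854523829918750, 539268062950384113869621968750,
     2892515611513612881249751187500, 4324565489569896680651070937500,
     2731558151405551900412226593750, 667997126985086841665114793750],
     [23566285713037188986392975000, 423404289432260295430376375000,
     2311456140673255711478825750000, 3468606068729643856343148750000,
     2188228351201005815039360875000, 533061320925394563731054475000],
     [11382962468871862380312687500, 207648252596626463601877187500,
     1154352074180461796945006875000, 1738604025394471638339384375000,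
     1095349524419284428349693437500, 265742733827519985733751437500],
     [3140378425508373535920625000, 58155259463964211200115625000, 329394523276258015360006250000,
     497925488116471648613531250000, 313238670965834228267903125000, 75667239587164757350183125000],
     [378848901826153256289453125, 7120908040859835957361328125, 41118462818020675200144531250,
     62382813978077915466035156250, 39181348822839882879634765625, 9421740336248959912672265625]] ?_
  simp only [defect, alphaRe, betaRe, constRe, constIm, topRe, halfBeta, betaIm, mixIm,
    slackP, deltaCentral,
    bernTable, bernForm, List.map_cons, List.map_nil, List.length_cons, List.length_nil,
    Nat.reduceAdd, Nat.cast_ofNat]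
  ring

/-- The value `-X(x) - δ(x, 0) ^ 2 / 32` of the slack for `M = 0`, `t = 0` is subtracted exactly,
since near `x = η` there is no room for a numerical lower bound of the sharp constant. -/
theorem central_left_slackP {x t : ℝ} (hx₀ : -3 / 20 ≤ x) (hx₁ : x ≤ 9 / 250)
    (ht₀ : 0 ≤ t) (ht₁ : t ≤ 23 / 100) :
    0 ≤ (slackP 0 (deltaCentral x t) (18 / 125) (247 / 100) 32 200 16 250 x t
      + (-48 * x ^ 4 - 96 * x ^ 3 - 392 * x ^ 2 + 24 * x + 357)
      + (23 / 200 * (24 - 784 * x - 288 * x ^ 2 - 192 * x ^ 3)) ^ 2 / 32) := by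
  obtain ⟨s, hs₀, hs₁, rfl⟩ := exists_eq_add_mul (by norm_num) hx₀ hx₁
  obtain ⟨τ, hτ₀, hτ₁, rfl⟩ := exists_eq_add_mul (by norm_num) ht₀ ht₁
  refine nonneg_of_mul_eq_bernTable (K := 1525878906250000000000000000) (by norm_num)
    hs₀ hs₁ hτ₀ hτ₁
    [[0, 20122008626408459930419921875, 78786671059004235839843750000,
     50286839434782954406738281250, 6019090094263193359375000000, 291681989915624237060546875], [0,
     169757065711575571545410156250, 769793488450410187377929687500, 736785101117121208056640625000,
     336542779703133149536132812500, 86952252507563432312011718750], [0,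
     606326581735685938888916015625, 3101941846261961858700195312500,
     3570266879963062671192871093750, 2014416253556253841184570312500,
     544818167258976152302978515625], [0, 1190211048261442362929062500000,
     6842867602663795936311953125000, 8776061873662103331444921875000,
     5384728819948275556107734375000, 1471430558967543923045703125000], [0,
     1390463554859289799461750000000, 9121221927502965107699023437500,
     12603169286087549378166592187500, 8064469871211078757176864062500,
     2204692780615977343497545312500], [0, 971201940367224998342410500000,
     7562950285051491925650271562500, 11084292740992188492406439187500,
     7256117605594798791231705687500, 1973680267565895351133127562500], [0,
     379490145924196019203750080000, 3820836033983650951455128000000,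
     5905498938934951217029889770000, 3912063594815314315415645860000,
     1052964073079327093137134010000], [0, 66808299491836547939789798400,
     1076755941079911840065580553600, 1756880225394715874689965370400,
     1168855546802137290129848273600, 309081114178213582565673658400], [0,
     1572997033413561835556323584, 129568575825684929966421974336, 224779602827268477184192044004,
     149263679759091874123843459336, 38374424621934374445517066084]] ?_
  simp only [defect, alphaRe, betaRe, constRe, constIm, topRe, halfBeta, betaIm, mixIm,
    slackP, deltaCentral,
    bernTable, bernForm, List.map_cons, List.map_nil, List.length_cons, List.length_nil,
    Nat.reduceAdd, Nat.cast_ofNat]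
  ring

/-! ### Certificates for `0.06 ≤ Re a ≤ 0.25` -/

/-- The parameter `δ` for `0.06 ≤ x ≤ 0.25`. -/
noncomputable def deltaMiddle (x t : ℝ) : ℝ :=
  -(37 / 20) + 92 * x + 57 / 10 * x ^ 2 + 193 / 2 * t

theorem middle_slackA {x t : ℝ} (hx₀ : 3 / 50 ≤ x) (hx₁ : x ≤ 1 / 4)
    (ht₀ : 0 ≤ t) (ht₁ : t ≤ 23 / 100) :
    0 ≤ slackA (714729 / 2000) (deltaMiddle x t) 160 320 x t := by
  obtain ⟨s, hs₀, hs₁, rfl⟩ := exists_eq_add_mul (by norm_num) hx₀ hx₁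
  obtain ⟨τ, hτ₀, hτ₁, rfl⟩ := exists_eq_add_mul (by norm_num) ht₀ ht₁
  refine nonneg_of_mul_eq_bernTable (K := 12500000) (by norm_num) hs₀ hs₁ hτ₀ hτ₁
    [[1225515342, 1577322784, 404707442], [5187825700, 6722800600, 1746574900], [8129992875,
     10487220350, 2674627475], [5585181250, 7088552500, 1714971250], [1417759375, 1747331250,
     382471875]] ?_
  simp only [defect, alphaRe, betaRe, constRe, topRe, halfBeta, slackA, deltaMiddle,
    bernTable, bernForm, List.map_cons, List.map_nil, List.length_cons, List.length_nil,
    Nat.reduceAdd, Nat.cast_ofNat]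
  ring

theorem middle_slackE {x t : ℝ} (hx₀ : 3 / 50 ≤ x) (hx₁ : x ≤ 1 / 4)
    (ht₀ : 0 ≤ t) (ht₁ : t ≤ 23 / 100) :
    0 ≤ slackE (deltaMiddle x t) 50 320 x t - 1 := by
  obtain ⟨s, hs₀, hs₁, rfl⟩ := exists_eq_add_mul (by norm_num) hx₀ hx₁
  obtain ⟨τ, hτ₀, hτ₁, rfl⟩ := exists_eq_add_mul (by norm_num) ht₀ ht₁
  refine nonneg_of_mul_eq_bernTable (K := 7812500000000) (by norm_num) hs₀ hs₁ hτ₀ hτ₁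
    [[50476927500000, 277993258682112, 394636678467424, 166738790165312], [377818417500000,
     1899223605468000, 2607645291082400, 1083691846634400], [1110546443125000, 5261957139965000,
     7054536914538200, 2896064369228200], [1675666437500000, 7622211960000000, 10041468024440000,
     4084526530460000], [1385076718750000, 6118249465625000, 7955132626375000, 3213383847880000],
     [599109375000000, 2589525390625000, 3333586962500000, 1339411343875000], [106494140625000,
     452760009765625, 578391894531250, 231441631640625]] ?_
  simp only [defect, betaRe, halfBeta, betaIm, slackE, deltaMiddle,
    bernTable, bernForm, List.map_cons, List.map_nil, List.length_cons, List.length_nil,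
    Nat.reduceAdd, Nat.cast_ofNat]
  ring

theorem middle_weight {x t : ℝ} (hx₀ : 3 / 50 ≤ x) (hx₁ : x ≤ 1 / 4)
    (ht₀ : 0 ≤ t) (ht₁ : t ≤ 23 / 100) :
    0 ≤ (714729 / 2000) - halfBeta x t + constRe x t - deltaMiddle x t
      - 144 * (defect x t * (5 / 4 + x + (x ^ 2 + t))) := by
  obtain ⟨s, hs₀, hs₁, rfl⟩ := exists_eq_add_mul (by norm_num) hx₀ hx₁
  obtain ⟨τ, hτ₀, hτ₁, rfl⟩ := exists_eq_add_mul (by norm_num) ht₀ ht₁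
  refine nonneg_of_mul_eq_bernTable (K := 12500000) (by norm_num) hs₀ hs₁ hτ₀ hτ₁
    [[1572021454, 3071158208, 1668416754], [5971698500, 11674232600, 6379654100], [8545007875,
     16699903550, 9170575675], [5477931250, 10691592500, 5890781250], [1335728125, 2601018750,
     1434570625]] ?_
  simp only [defect, betaRe, constRe, halfBeta, deltaMiddle,
    bernTable, bernForm, List.map_cons, List.map_nil, List.length_cons, List.length_nil,
    Nat.reduceAdd, Nat.cast_ofNat]
  ring

theorem middle_slackDet_low {x t : ℝ} (hx₀ : 3 / 50 ≤ x) (hx₁ : x ≤ 1 / 4)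
    (ht₀ : 0 ≤ t) (ht₁ : t ≤ 1 / 20) :
    0 ≤ slackDet (deltaMiddle x t) 50 8 320 x t := by
  obtain ⟨s, hs₀, hs₁, rfl⟩ := exists_eq_add_mul (by norm_num) hx₀ hx₁
  obtain ⟨τ, hτ₀, hτ₁, rfl⟩ := exists_eq_add_mul (by norm_num) ht₀ ht₁
  refine nonneg_of_mul_eq_bernTable (K := 39062500000000000000000) (by norm_num) hs₀ hs₁ hτ₀ hτ₁
    [[3425798997188509895059456, 18522125401548589928308736, 41836315411007016655651840,
     50563929395977855240709120, 34509180971668466645411840, 12616007520788293920116736,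
     1930767000950745893011456], [42973863400585817113497600, 234808790351979999931289600,
     537526238730748339513984000, 660558932164715241012992000, 460011268687849678565504000,
     172249985506286895172505600, 27106337953798300923801600], [241587988887860425655936000,
     1330005909432247132914368000, 3075072931228673313072800000, 3826702622516070136266240000,
     2705973894636152662166560000, 1031630364088152557189376000, 165704085408783425474688000],
     [806280779794418714307200000, 4462158717317873226481600000, 10395114601526496644360000000,
     13066302589350236648768000000, 9355805357133634755352000000, 3620053531250317295275200000,
     591314113213877056505600000], [1779868113775391331295000000, 9883262275709785247697000000,
     23157883117937469763950000000, 29353964055348744273480000000, 21249655174752307681785000000,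
     8331850359648714598215000000, 1381670315179575342362000000], [2735198413245609744125000000,
     15211363893062498488200000000, 35797458735854467438675000000, 45709998814440865445200000000,
     33431625152425905423675000000, 13277463579220500290200000000, 2234544034697881617125000000],
     [2992692198834322707031250000, 16635601353732099105937500000, 39266367513842982561656250000,
     50478272179032176292875000000, 37303057424836668337593750000, 15014919075152303755687500000,
     2566675528152605548218750000], [2337700369780621953125000000, 12954986881331376484375000000,
     30624155776100029796875000000, 39624921148159390256250000000, 29614870671212321284375000000,
     12102872387639690284375000000, 2106053649537483990625000000], [1282800045431389526367187500,
     7059495264547105688476562500, 16678305768825762695312500000, 21724869460958836486328125000,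
     16458136608188725401367187500, 6854214025436332090820312500, 1219336359433896642578125000],
     [474671873336282348632812500, 2575884692007779541015625000, 6060699980188717163085937500,
     7954476806092201464843750000, 6138175804594530346679687500, 2624329822691746337890625000,
     481143676422197485351562500], [108803881721858978271484375, 573300126266120910644531250,
     1332806603418466949462890625, 1767121145495228881835937500, 1405517851546357818603515625,
     627221608282883605957031250, 120514547482549652099609375], [12749647862434387207031250,
     62151353042221069335937500, 138961391492118835449218750, 187959608130889892578125000,
     160388191711979675292968750, 78484293866390991210937500, 16496024722969055175781250],
     [396919763088226318359375, 1167271971702575683593750, 1644473095417022705078125,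
     2724505414199829101562500, 4026310701541900634765625, 3002159992637634277343750,
     826233880992889404296875]] ?_
  simp only [defect, betaRe, constRe, constIm, halfBeta, betaIm, slackE, slackDet, deltaMiddle,
    bernTable, bernForm, List.map_cons, List.map_nil, List.length_cons, List.length_nil,
    Nat.reduceAdd, Nat.cast_ofNat]
  ring

theorem middle_slackDet_high {x t : ℝ} (hx₀ : 3 / 50 ≤ x) (hx₁ : x ≤ 1 / 4)
    (ht₀ : 1 / 20 ≤ t) (ht₁ : t ≤ 23 / 100) :
    0 ≤ slackDet (deltaMiddle x t) 50 8 320 x t := by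
  obtain ⟨s, hs₀, hs₁, rfl⟩ := exists_eq_add_mul (by norm_num) hx₀ hx₁
  obtain ⟨τ, hτ₀, hτ₁, rfl⟩ := exists_eq_add_mul (by norm_num) ht₀ ht₁
  refine nonneg_of_mul_eq_bernTable (K := 39062500000000000000000) (by norm_num) hs₀ hs₁ hτ₀ hτ₁
    [[1930767000950745893011456, 7871542151402728534695936, 15459008773319337580707840,
     18379488384351684276101120, 12313489356801764295843840, 3554778221197938770804736,
     102679674776503812038656], [27106337953798300923801600, 128034979702200282875904000,
     302998908809557627140096000, 432390899451554572517376000, 354994628209256509613568000,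
     147314963005113001398681600, 22642599773007419114496000], [165704085408783425474688000,
     859563446565073337219635200, 2244904236733366012064256000, 3463432253601518228754432000,
     3042042041365820083953792000, 1370026828292820996651264000, 240381144178579041132595200],
     [591314113213877056505600000, 3288076812201864496563840000, 9193904575010212115452800000,
     14912387585267477807084800000, 13620964272724643846592000000, 6388591709102436189955200000,
     1182903076380165475053440000], [1381670315179575342362000000, 8139439404220906895617200000,
     24060479323873552489430400000, 40594130626161364352389600000, 38168323192247620261328400000,
     18390560303831383799295600000, 3513724847116426954181600000], [2234544034697881617125000000,
     13874546472467731587930000000, 43144154229089935537743000000, 75384262781589893366812000000,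
     72639111976609898336403000000, 35739037551292093046442000000, 6980144315677634509913000000],
     [2566675528152605548218750000, 16786535906463619610362500000, 54875137438909471688921250000,
     99155848448547425231475000000, 97722647704447285081241250000, 48948472651319249261242500000,
     9726522044000835784698750000], [2106053649537483990625000000, 14556740131731673117500000000,
     50152318565542746923625000000, 93752889270650834165600000000, 94438460113761094350675000000,
     48082488118309605855300000000, 9695392942576419873475000000], [1219336359433896642578125000,
     8978513028804751808203125000, 32785889620316378436093750000, 63517980185395677541906250000,
     65404596453505698852515625000, 33823686253733597238140625000, 6910424378881572657062500000],
     [481143676422197485351562500, 3831978107562363779296875000, 14971252005073998366210937500,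
     30152417232747931378906250000, 31762818529154269372148437500, 16680977753363556888046875000,
     3450188813780506822539062500], [120514547482549652099609375, 1068203720699989416503906250,
     4532879561179294332275390625, 9534352336584915206054687500, 10288900769281245608056640625,
     5488509075181475037128906250, 1148779233750426067255859375], [16496024722969055175781250,
     172746824434938354492187500, 815969679520460632324218750, 1804311824487040087890625000,
     1998682043228534187011718750, 1083580438744945198242187500, 229492972781711766113281250],
     [826233880992889404296875, 11996279141908264160156250, 65848773128730010986328125,
     154536255342413940429687500, 176207913350426055908203125, 97180643184906350097656250,
     20830393357975598388671875]] ?_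
  simp only [defect, betaRe, constRe, constIm, halfBeta, betaIm, slackE, slackDet, deltaMiddle,
    bernTable, bernForm, List.map_cons, List.map_nil, List.length_cons, List.length_nil,
    Nat.reduceAdd, Nat.cast_ofNat]
  ring

theorem middle_slackP_low {x t : ℝ} (hx₀ : 3 / 50 ≤ x) (hx₁ : x ≤ 1 / 4)
    (ht₀ : 0 ≤ t) (ht₁ : t ≤ 1 / 20) :
    0 ≤ slackP (714729 / 2000) (deltaMiddle x t) 0 (78 / 25) 50 160 8 320 x t := by
  obtain ⟨s, hs₀, hs₁, rfl⟩ := exists_eq_add_mul (by norm_num) hx₀ hx₁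
  obtain ⟨τ, hτ₀, hτ₁, rfl⟩ := exists_eq_add_mul (by norm_num) ht₀ ht₁
  refine nonneg_of_mul_eq_bernTable (K := 19531250000000000000) (by norm_num) hs₀ hs₁ hτ₀ hτ₁
    [[1653502394375000000, 11300508226822283376, 89424299973431993504, 188326756268643030256,
     150459077942404213504, 41635455564745893376], [51956052296250000000, 145286225051799834400,
     749909416494469957600, 1615245339043308866400, 1347151029169157197600, 386291651864768454400],
     [484969430358437500000, 1222122855643160435000, 3321735370861514775000, 6272232936870753715000,
     5215930160537417345000, 1520602682243455470000], [1922908579366562500000,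
     4855776533312424625000, 8933270322913091650000, 13942614457099050200000,
     11274695640675711450000, 3317130578543890775000], [4043923324026210937500,
     10211488798934450859375, 14718560389829073187500, 18839245677035298281250,
     14673091682290125750000, 4365649702675660734375], [4920130413324218750000,
     12266903069417117187500, 14695362256074481250000, 15332091161145378125000,
     11506427658954687500000, 3507573123790892187500], [3496174665283203125000,
     8490304999566894531250, 8518293954213125000000, 6940433874173664062500, 5060016121199515625000,
     1636069379955285156250], [1352460725097656250000, 3152802255532226562500,
     2553597039101562500000, 1359946852606640625000, 987599418549218750000, 378714792609570312500],
     [220734848022460937500, 485517752655029296875, 283992346557617187500, 9459555822753906250,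
     16244032230468750000, 25719758082763671875]] ?_
  simp only [defect, alphaRe, betaRe, constRe, constIm, topRe, halfBeta, betaIm, mixIm,
    slackP, deltaMiddle,
    bernTable, bernForm, List.map_cons, List.map_nil, List.length_cons, List.length_nil,
    Nat.reduceAdd, Nat.cast_ofNat]
  ring

theorem middle_slackP_high {x t : ℝ} (hx₀ : 3 / 50 ≤ x) (hx₁ : x ≤ 1 / 4)
    (ht₀ : 1 / 20 ≤ t) (ht₁ : t ≤ 23 / 100) :
    0 ≤ slackP (714729 / 2000) (deltaMiddle x t) 0 (78 / 25) 50 160 8 320 x t := by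
  obtain ⟨s, hs₀, hs₁, rfl⟩ := exists_eq_add_mul (by norm_num) hx₀ hx₁
  obtain ⟨τ, hτ₀, hτ₁, rfl⟩ := exists_eq_add_mul (by norm_num) ht₀ ht₁
  refine nonneg_of_mul_eq_bernTable (K := 97656250000000000000) (by norm_num) hs₀ hs₁ hτ₀ hτ₁
    [[208177277823729466880, 2079813986982501895168, 6421839179184948039872, 6338731330156940777408,
     3859030475687517681472, 1241630519121552515648], [1931458259323842272000,
     20174821439403542699200, 67188044782106575452800, 70865030662022122323200,
     39809725934366197724800, 11258408102889350427200], [7603013411217277350000,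
     80982565568323866840000, 287722262952808103328000, 314595410822228606604000,
     165014079038070783834000, 41552988311358091068000], [16585652892719453875000,
     178525495000384633025000, 678826372727659260670000, 762064897121106392050000,
     374083687868126664815000, 82488539966643154285000], [21828248513378303671875,
     237934065526478720953125, 979912540128246737193750, 1127882299770646029941250,
     518048766287332013754375, 95952212881368303725625], [17537865618954460937500,
     196255211374768226562500, 893603031567191936875000, 1057682971255133796625000,
     454884420690015104187500, 65670353845888278812500], [8180346899776425781250,
     97067688513266511718750, 504824179697865551562500, 618134790913772282187500,
     249977672529032947656250, 24571328999450531093750], [1893573963047851562500,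
     25775411616214648437500, 161711879206334453125000, 206603709643447984375000,
     79337402472903945312500, 3932765611142017187500], [128598790413818359375,
     2665379599369384765625, 22444459794147167968750, 30260135255527128906250,
     11212471311429201171875, 31143944658473828125]] ?_
  simp only [defect, alphaRe, betaRe, constRe, constIm, topRe, halfBeta, betaIm, mixIm,
    slackP, deltaMiddle,
    bernTable, bernForm, List.map_cons, List.map_nil, List.length_cons, List.length_nil,
    Nat.reduceAdd, Nat.cast_ofNat]
  ring

/-! ### Certificates for `0.25 ≤ Re a ≤ 0.465` -/

/-- The parameter `δ` for `0.25 ≤ x ≤ 0.465`. -/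
noncomputable def deltaRight (x t : ℝ) : ℝ :=
  33 / 10 + 1287 / 10 * x + 333 / 10 * x ^ 2 + 36 * t

theorem right_slackA {x t : ℝ} (hx₀ : 1 / 4 ≤ x) (hx₁ : x ≤ 93 / 200)
    (ht₀ : 0 ≤ t) (ht₁ : t ≤ 23 / 100) :
    0 ≤ slackA (714729 / 2000) (deltaRight x t) 200 250 x t := by
  obtain ⟨s, hs₀, hs₁, rfl⟩ := exists_eq_add_mul (by norm_num) hx₀ hx₁
  obtain ⟨τ, hτ₀, hτ₁, rfl⟩ := exists_eq_add_mul (by norm_num) ht₀ ht₁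
  refine nonneg_of_mul_eq_bernTable (K := 100000000) (by norm_num) hs₀ hs₁ hτ₀ hτ₁
    [[12737075000, 18160150000, 5846275000], [50639775000, 69570830000, 20623855000], [74150340750,
     96480154300, 24869013550], [47186543900, 56602193400, 11108449500], [10942321951, 11539556702,
     1020434751]] ?_
  simp only [defect, alphaRe, betaRe, constRe, topRe, halfBeta, slackA, deltaRight,
    bernTable, bernForm, List.map_cons, List.map_nil, List.length_cons, List.length_nil,
    Nat.reduceAdd, Nat.cast_ofNat]
  ring

theorem right_slackE {x t : ℝ} (hx₀ : 1 / 4 ≤ x) (hx₁ : x ≤ 93 / 200)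
    (ht₀ : 0 ≤ t) (ht₁ : t ≤ 23 / 100) :
    0 ≤ slackE (deltaRight x t) 70 250 x t - 1 := by
  obtain ⟨s, hs₀, hs₁, rfl⟩ := exists_eq_add_mul (by norm_num) hx₀ hx₁
  obtain ⟨τ, hτ₀, hτ₁, rfl⟩ := exists_eq_add_mul (by norm_num) ht₀ ht₁
  refine nonneg_of_mul_eq_bernTable (K := 390625000000000) (by norm_num) hs₀ hs₁ hτ₀ hτ₁
    [[3781738281250000, 12414355468750000, 13179321093750000, 4502902706250000], [29186621093750000,
     94342491406250000, 99463847931250000, 34020057730750000], [88869372070312500,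
     284582225354687500, 298800864046437500, 102301829836782500], [139494502343750000,
     443977619728750000, 464965607673290000, 159340941467170000], [120434120710937500,
     381727841170410000, 399116230824544300, 136892768573391800], [54619546890625000,
     172623709757475500, 180292400527029600, 61885469079059100], [10215439265625000,
     32219253507277873, 33625149384137546, 11548821769204673]] ?_
  simp only [defect, betaRe, halfBeta, betaIm, slackE, deltaRight,
    bernTable, bernForm, List.map_cons, List.map_nil, List.length_cons, List.length_nil,
    Nat.reduceAdd, Nat.cast_ofNat]
  ring

theorem right_weight {x t : ℝ} (hx₀ : 1 / 4 ≤ x) (hx₁ : x ≤ 93 / 200)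
    (ht₀ : 0 ≤ t) (ht₁ : t ≤ 23 / 100) :
    0 ≤ (714729 / 2000) - halfBeta x t + constRe x t - deltaRight x t
      - 144 * (defect x t * (5 / 4 + x + (x ^ 2 + t))) := by
  obtain ⟨s, hs₀, hs₁, rfl⟩ := exists_eq_add_mul (by norm_num) hx₀ hx₁
  obtain ⟨τ, hτ₀, hτ₁, rfl⟩ := exists_eq_add_mul (by norm_num) ht₀ ht₁
  refine nonneg_of_mul_eq_bernTable (K := 50000000) (by norm_num) hs₀ hs₁ hτ₀ hτ₁
    [[4540412500, 9494825000, 5631532500], [17007637500, 35592155000, 21292997500], [24359867875,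
     50864310950, 30567163075], [16017487250, 33249484900, 19940477650], [4145357181, 8523529562,
     5055292381]] ?_
  simp only [defect, betaRe, constRe, halfBeta, deltaRight,
    bernTable, bernForm, List.map_cons, List.map_nil, List.length_cons, List.length_nil,
    Nat.reduceAdd, Nat.cast_ofNat]
  ring

theorem right_slackDet_low {x t : ℝ} (hx₀ : 1 / 4 ≤ x) (hx₁ : x ≤ 93 / 200)
    (ht₀ : 0 ≤ t) (ht₁ : t ≤ 2 / 25) :
    0 ≤ slackDet (deltaRight x t) 70 (25 / 2) 250 x t := by
  obtain ⟨s, hs₀, hs₁, rfl⟩ := exists_eq_add_mul (by norm_num) hx₀ hx₁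
  obtain ⟨τ, hτ₀, hτ₁, rfl⟩ := exists_eq_add_mul (by norm_num) ht₀ ht₁
  refine nonneg_of_mul_eq_bernTable (K := 31250000000000000000000000) (by norm_num) hs₀ hs₁ hτ₀ hτ₁
    [[3543901062011718750000000000, 17254652934570312500000000000, 34690037822675781250000000000,
     36913043556434375000000000000, 21990529853543781250000000000, 6992287458848712500000000000,
     935516285363942750000000000], [46667351716308593750000000000, 234993234775351562500000000000,
     495656817935328906250000000000, 563673553354739875000000000000, 367042456543892586250000000000,
     130730220388553354500000000000, 20030395208016593750000000000],
     [275666106940522460937500000000, 1425067612704834765625000000000,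
     3115327451660608914062500000000, 3709608527967069058750000000000,
     2552753115074286795662500000000, 966653053854984197945000000000,
     157582591718430235657500000000], [967249596890116796875000000000,
     5107560255840947781250000000000, 11487454689680816713125000000000,
     14166703825296853707100000000000, 10142878951902105759845000000000,
     4001174355944605257090000000000, 677855434832568755595000000000],
     [2245199891401721316406250000000, 12066430597127856558437500000000,
     27791577590715644185293750000000, 35276710148143533494653000000000,
     26068274240816588579437750000000, 10611802419311733472741500000000,
     1849891973151372324694250000000], [3626927953718667987031250000000,
     19784196757930410076987500000000, 46528189682754537722892750000000,
     60583616487450543284298600000000, 46021620095783702338505550000000,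
     19245775452676463067336300000000, 3436851816204032988192850000000],
     [4167707507365670121598437500000, 23023587445427869654406625000000,
     55199985004409909311516402500000, 73631649197552520775071470000000,
     57417195694154314944525682500000, 24627738005442660646660065000000,
     4498087434630602074497637500000], [3412805329655524642053500000000,
     19056707339449707757656200000000, 46560422595984865510827108000000,
     63664155422743305588074992000000, 51006300812249469552221828000000,
     22455158342156367185807112000000, 4196493216863045434435868000000],
     [1956461509129745813775597187500, 11021575636159904333610954325000,
     27474247480392213790482343412500, 38630105547646727503930174150000,
     31914361335581537893892047412500, 14466308557097104007721757525000,
     2772919947302441227112897987500], [751170357036148463659033337500,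
     4259397096789771875479199065000, 10875704232663777409827333662500,
     15845678833423222076725210750000, 13609458512988800786478120862500,
     6394743033036714121048148825000, 1263486096784182693288070777500],
     [175890314210038726649236557875, 1000021796953937044977958944050,
     2644105386892243368625063952125, 4066019921157040139977397525500,
     3695335611483144890382849936125, 1824268350894475800739387731250,
     374978827286986384037593754675], [20038085073874502662669604850,
     112974365481716128015584502700, 321415739675470225029116840750, 551207642695417093978174433000,
     554304289207708902695623208750, 296005692289556922671285597100, 64429599394538402277634878450],
     [389443940971197117169120574, 1891308719174727546869840244, 8910806202106674762309992610,
     24029378141563661849683979480, 31694591112868578886353576610, 19824422192695285361560707444,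
     4750268871229047992281837374]] ?_
  simp only [defect, betaRe, constRe, constIm, halfBeta, betaIm, slackE, slackDet, deltaRight,
    bernTable, bernForm, List.map_cons, List.map_nil, List.length_cons, List.length_nil,
    Nat.reduceAdd, Nat.cast_ofNat]
  ring

theorem right_slackDet_high {x t : ℝ} (hx₀ : 1 / 4 ≤ x) (hx₁ : x ≤ 93 / 200)
    (ht₀ : 2 / 25 ≤ t) (ht₁ : t ≤ 23 / 100) :
    0 ≤ slackDet (deltaRight x t) 70 (25 / 2) 250 x t := by
  obtain ⟨s, hs₀, hs₁, rfl⟩ := exists_eq_add_mul (by norm_num) hx₀ hx₁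
  obtain ⟨τ, hτ₀, hτ₁, rfl⟩ := exists_eq_add_mul (by norm_num) ht₀ ht₁
  refine nonneg_of_mul_eq_bernTable (K := 31250000000000000000000000) (by norm_num) hs₀ hs₁ hτ₀ hτ₁
    [[935516285363942750000000000, 3027116937186676500000000000, 4835860545253241250000000000,
     6705017551185055000000000000, 7387208714043341250000000000, 4481985600994756500000000000,
     1055581200705962750000000000], [20030395208016593750000000000, 100405154109748702500000000000,
     250251695745827606250000000000, 383074199166755275000000000000, 351859539131138306250000000000,
     173679250012677262500000000000, 35017533076198733750000000000],
     [157582591718430235657500000000, 905825231164826193945000000000,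
     2457981223087667304862500000000, 3836501456091203193150000000000,
     3458959525978676154862500000000, 1656812050856478393945000000000,
     324618476623734085657500000000], [677855434832568755595000000000,
     4190804333465676176970000000000, 11857888680780668798925000000000,
     18752197777245237897900000000000, 16858185209469394535925000000000,
     8004773785332942222570000000000, 1553856835281224206995000000000],
     [1849891973151372324694250000000, 12013507000651672339585500000000,
     34982739653548931036613750000000, 55977677361695016560485000000000,
     50441181243930523587213750000000, 23912820674796313889665500000000,
     4630215261232175841214250000000], [3436851816204032988192850000000,
     23199864855751200795071100000000, 69176891050991187442482750000000,
     112009900630447456594277000000000, 101439978307238095855752750000000,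
     48180698495959085652407100000000, 9336779759276426755326850000000],
     [4498087434630602074497637500000, 31414999487172897072596625000000,
     95755386962343104815131562500000, 156997500856230758264832750000000,
     143165351326249832712210562500000, 68274487767322296974451825000000,
     13268205497646412710041437500000], [4196493216863045434435868000000,
     30286086099344345270630388000000, 94381925286635355874707120000000,
     156878412506154498423961960000000, 144276627702255795213409020000000,
     69195230975637296907223908000000, 13504720326933944079264248000000],
     [2772919947302441227112897987500, 20708540546410041153219194925000,
     66085450333722074217914444812500, 111545760535451121622523789750000,
     103626227919444971885583179812500, 50052370076612677371834182925000,
     9822096052724352816966644987500], [1263486096784182693288070777500,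
     9804991982583312482253941865000, 32139978303384968584224407662500,
     55215766164188579786519627550000, 51908516895801977877430793662500,
     25285844703872544480659050665000, 4994631818993307594489347977500],
     [374978827286986384037593754675, 3047881612773372998262140272050,
     10313196903327715646859435040125, 18090398656903712229568212533500,
     17246867508535720629605523760125, 8485858035928140470859011248050,
     1689098145750803038186811498675], [64429599394538402277634878450,
     556399916512868209280541158700, 1958711204186109899555942616750,
     3523476613267919120891056449000, 3415787186403855223978402056750,
     1700578430043442050770508710700, 341527529711725855130126766450],
     [4750268871229047992281837374, 44771346417397417813935368244, 166055284549977481554589280610,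
     308284005748257557044640187480, 304980106847094240061511000610, 153975049501328934091472744244,
     31244788054683139341666181374]] ?_
  simp only [defect, betaRe, constRe, constIm, halfBeta, betaIm, slackE, slackDet, deltaRight,
    bernTable, bernForm, List.map_cons, List.map_nil, List.length_cons, List.length_nil,
    Nat.reduceAdd, Nat.cast_ofNat]
  ring

theorem right_slackP_low {x t : ℝ} (hx₀ : 1 / 4 ≤ x) (hx₁ : x ≤ 93 / 200)
    (ht₀ : 0 ≤ t) (ht₁ : t ≤ 2 / 25) :
    0 ≤ slackP (714729 / 2000) (deltaRight x t) (9 / 25) (223 / 100) 70 200 (25 / 2) 250 x t := by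
  obtain ⟨s, hs₀, hs₁, rfl⟩ := exists_eq_add_mul (by norm_num) hx₀ hx₁
  obtain ⟨τ, hτ₀, hτ₁, rfl⟩ := exists_eq_add_mul (by norm_num) ht₀ ht₁
  refine nonneg_of_mul_eq_bernTable (K := 87500000000000000000000) (by norm_num) hs₀ hs₁ hτ₀ hτ₁
    [[35210107421875000000000, 168881802847500000000000, 1417696958835250000000000,
     3109404577090380000000000, 2547186617144499000000000, 717365740734067200000000],
     [978387855468750000000000, 3392825416304075000000000, 15017654730881760000000000,
     29596391072948918800000000, 23566373600389681040000000, 6537667195649782840000000],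
     [6447123564257812500000000, 20055661743736438750000000, 66093027050719950000000000,
     120950688448099381156000000, 94567577225272401996000000, 25977013891983394190000000],
     [20113327772707812500000000, 57522066438411396690000000, 157649643271683452544000000,
     275414051911681251778400000, 214050789669899795048800000, 58628914851336510824400000],
     [35644665397421179687500000, 93274860353729490730650000, 221813719366841204255600000,
     379361475199322487304620000, 297446413180726683287540000, 81957553000859713195370000],
     [38116046221981593750000000, 89558606841763085460280000, 185886803988550698003584000,
     319907610450963559191952000, 258067959025633433944272000, 72355864430577180245624000],
     [24466832501659890625000000, 49905245688232909445787600, 87447993245592308594731200,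
     157742730229555002231788000, 134995518355274972137532800, 39138004428308309279688400],
     [8713256320161281250000000, 14555627767538808406701440, 19004793383034093174575360,
     39522504474366866090397440, 38123607982844672737874560, 11727992942296958265351040],
     [1327186599558679687500000, 1624284219952853559077733, 785688130088598585963732,
     3275103522784306739544798, 4251264278276334064009332, 1460309702456775238850533]] ?_
  simp only [defect, alphaRe, betaRe, constRe, constIm, topRe, halfBeta, betaIm, mixIm,
    slackP, deltaRight,
    bernTable, bernForm, List.map_cons, List.map_nil, List.length_cons, List.length_nil,
    Nat.reduceAdd, Nat.cast_ofNat]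
  ring

theorem right_slackP_high {x t : ℝ} (hx₀ : 1 / 4 ≤ x) (hx₁ : x ≤ 93 / 200)
    (ht₀ : 2 / 25 ≤ t) (ht₁ : t ≤ 23 / 100) :
    0 ≤ slackP (714729 / 2000) (deltaRight x t) (9 / 25) (223 / 100) 70 200 (25 / 2) 250 x t := by
  obtain ⟨s, hs₀, hs₁, rfl⟩ := exists_eq_add_mul (by norm_num) hx₀ hx₁
  obtain ⟨τ, hτ₀, hτ₁, rfl⟩ := exists_eq_add_mul (by norm_num) ht₀ ht₁
  refine nonneg_of_mul_eq_bernTable (K := 700000000000000000000000) (by norm_num) hs₀ hs₁ hτ₀ hτ₁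
    [[5738925925872537600000000, 44289260927250243000000000, 122420408333642796000000000,
     148423650876930306000000000, 83959735918970508000000000, 18582718018385292600000000],
     [52301337565198262720000000, 398336123493879811000000000, 1090231485982887264800000000,
     1285036051108787315600000000, 687528915697099967200000000, 140102041795158368120000000],
     [207816111135867153520000000, 1568842939199004301910000000, 4266131477317325158840000000,
     4889943756296305832260000000, 2448803711907690748040000000, 440908274899812926230000000],
     [469031318810692086595200000, 3531563362855201819074000000, 9590628937404588342984000000,
     10721212244767247050860000000, 4986198069576871436088000000, 746970058238182995733200000],
     [655660424006877705562960000, 4963422397387966768154450000, 13554467138124077438780200000,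
     14864333463853069753163500000, 6405363333744838534789400000, 730094209720357157814610000],
     [578846915444617441964992000, 4449905024131874219082680000, 12325993966730743184305600000,
     13376877888246380954550640000, 5374812493383588422690240000, 406757803249173875327512000],
     [313104035426466474237507200, 2475937733926330985101174000, 7029792799640171255238584000,
     7634426242306217730203780000, 2907813837305137263908968000, 117290366173466278080105200],
     [93823943538375666122808320, 776865068621480109447251200, 2290383394394725714472441600,
     2520712961294399604441900800, 933111002715830892641440000, 13152787885692559347537920],
     [11682477619654201910804264, 104166651608384141507671315, 324398989325183627698002620,
     366679280646201881676022610, 135690596944936356734701300, 102691279268163159814259]] ?_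
  simp only [defect, alphaRe, betaRe, constRe, constIm, topRe, halfBeta, betaIm, mixIm,
    slackP, deltaRight,
    bernTable, bernForm, List.map_cons, List.map_nil, List.length_cons, List.length_nil,
    Nat.reduceAdd, Nat.cast_ofNat]
  ring

/-! ### The inner region -/

theorem slackP_eq_add (M M₀ δ μ l E₁ A₁ D₁ A₂ x t : ℝ) :
    slackP M δ μ l E₁ A₁ D₁ A₂ x t = slackP M₀ δ μ l E₁ A₁ D₁ A₂ x t + (M - M₀) := by
  unfold slackP
  ring

theorem slackA_eq_add (M M₀ δ A₁ A₂ x t : ℝ) :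
    slackA M δ A₁ A₂ x t = slackA M₀ δ A₁ A₂ x t + (M - M₀) := by
  unfold slackA
  ring

/-- In the inner region the form is positive semidefinite for a suitable `δ`, for every `M` that
is at least the rational lower bound and dominates `X` quantitatively near its maximum. The last
conjunct compares the weight `m₁` with `144 (1 - |a|²) |1 + 2 a|`. The constants `μ`, `l`, `E₁`,
`A₁`, `D₁`, `A₂` come from a numerical optimization. -/
theorem exists_majorantForm_nonneg {M x y : ℝ} (hM : 178682299 / 500000 ≤ M)
    (hgap : -48 * x ^ 4 - 96 * x ^ 3 - 392 * x ^ 2 + 24 * x + 357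
      + (23 / 200 * (24 - 784 * x - 288 * x ^ 2 - 192 * x ^ 3)) ^ 2 / 32 ≤ M ∨ 9 / 250 ≤ x)
    (hx₀ : -3 / 20 ≤ x) (hx₁ : x ≤ 93 / 200) (hy : y ^ 2 ≤ 23 / 100) :
    ∃ δ : ℝ, (∀ p e u v, 0 ≤ majorantForm M δ x y p e u v) ∧
      144 * (defect x (y ^ 2) * (5 / 4 + x + (x ^ 2 + y ^ 2)))
        ≤ M - halfBeta x (y ^ 2) + constRe x (y ^ 2) - δ := by
  have hy₀ : 0 ≤ y ^ 2 := sq_nonneg y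
  rcases le_total x (3 / 50) with h₁ | h₁
  · refine ⟨deltaCentral x (y ^ 2), form_nonneg_of_slack (μ := 18 / 125) (l := 247 / 100)
      (E₁ := 32) (A₁ := 200) (D₁ := 16) (A₂ := 250) (by norm_num) (by norm_num) (by norm_num)
      (by norm_num) ?_ (by linarith [central_slackE hx₀ h₁ hy₀ hy])
      (central_slackDet hx₀ h₁ hy₀ hy) ?_, by linarith [central_weight hx₀ h₁ hy₀ hy]⟩
    · rw [slackA_eq_add M (178682299 / 500000)]
      linarith [central_slackA hx₀ h₁ hy₀ hy]
    · rcases le_total x (9 / 250) with h₂ | h₂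
      · rcases hgap with hgap | h₃
        · rw [slackP_eq_add M 0]
          linarith [central_left_slackP hx₀ h₂ hy₀ hy]
        · obtain rfl : x = 9 / 250 := le_antisymm h₂ h₃
          rw [slackP_eq_add M (178682299 / 500000)]
          rcases le_total (y ^ 2) (3 / 100) with h₄ | h₄
          · linarith [central_right_slackP_low h₃ h₁ hy₀ h₄]
          · linarith [central_right_slackP_high h₃ h₁ h₄ hy]
      · rw [slackP_eq_add M (178682299 / 500000)]
        rcases le_total (y ^ 2) (3 / 100) with h₄ | h₄
        · linarith [central_right_slackP_low h₂ h₁ hy₀ h₄]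
        · linarith [central_right_slackP_high h₂ h₁ h₄ hy]
  rcases le_total x (1 / 4) with h₂ | h₂
  · refine ⟨deltaMiddle x (y ^ 2), form_nonneg_of_slack (μ := 0) (l := 78 / 25)
      (E₁ := 50) (A₁ := 160) (D₁ := 8) (A₂ := 320) (by norm_num) (by norm_num) (by norm_num)
      (by norm_num) ?_ (by linarith [middle_slackE h₁ h₂ hy₀ hy]) ?_ ?_,
      by linarith [middle_weight h₁ h₂ hy₀ hy]⟩
    · rw [slackA_eq_add M (714729 / 2000)]
      linarith [middle_slackA h₁ h₂ hy₀ hy]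
    · rcases le_total (y ^ 2) (1 / 20) with h₄ | h₄
      · exact middle_slackDet_low h₁ h₂ hy₀ h₄
      · exact middle_slackDet_high h₁ h₂ h₄ hy
    · rw [slackP_eq_add M (714729 / 2000)]
      rcases le_total (y ^ 2) (1 / 20) with h₄ | h₄
      · linarith [middle_slackP_low h₁ h₂ hy₀ h₄]
      · linarith [middle_slackP_high h₁ h₂ h₄ hy]
  · refine ⟨deltaRight x (y ^ 2), form_nonneg_of_slack (μ := 9 / 25) (l := 223 / 100)
      (E₁ := 70) (A₁ := 200) (D₁ := 25 / 2) (A₂ := 250) (by norm_num) (by norm_num)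
      (by norm_num) (by norm_num) ?_ (by linarith [right_slackE h₂ hx₁ hy₀ hy]) ?_ ?_,
      by linarith [right_weight h₂ hx₁ hy₀ hy]⟩
    · rw [slackA_eq_add M (714729 / 2000)]
      linarith [right_slackA h₂ hx₁ hy₀ hy]
    · rcases le_total (y ^ 2) (2 / 25) with h₄ | h₄
      · exact right_slackDet_low h₂ hx₁ hy₀ h₄
      · exact right_slackDet_high h₂ hx₁ h₄ hy
    · rw [slackP_eq_add M (714729 / 2000)]
      rcases le_total (y ^ 2) (2 / 25) with h₄ | h₄
      · linarith [right_slackP_low h₂ hx₁ hy₀ h₄]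
      · linarith [right_slackP_high h₂ hx₁ h₄ hy]

/-! ### The outer region -/

/-- An upper bound for `|C| + r |α| + r |β|` as a polynomial in `x = Re a` and `ρ = |a|²`. It comes
from `|z| ≤ (|z|² + m²) / (2 m)` for `z = α`, `β` and `11 + 56 a`, with `m = m₁`, `m₂`, `m₃`, and
from `|a|³ ≤ ρ (ρ + 1 / 4)`. -/
noncomputable def outerBound (m₁ m₂ m₃ x ρ : ℝ) : ℝ :=
  (121 + 1232 * x + 3136 * ρ + m₃ ^ 2) / (2 * m₃) + 8 * ρ + 16 * (ρ * (ρ + 1 / 4)) + 80 * ρ ^ 2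
    + (1 - ρ) * ((65536 + 73728 * x + 37120 * ρ + 9216 * x * ρ + 1024 * ρ ^ 2 + m₁ ^ 2) / (2 * m₁)
      + (12544 + 4096 * ρ + 4096 * ρ ^ 2 - 14336 * x - 14336 * (2 * x ^ 2 - ρ) + 8192 * ρ * x
        + m₂ ^ 2) / (2 * m₂))

theorem outerBound_left {x ρ : ℝ} (hx₀ : -1 ≤ x) (hx₁ : x ≤ -3 / 20)
    (hρ₀ : 9 / 400 ≤ ρ) (hρ₁ : ρ ≤ 1) :
    0 ≤ 357 - outerBound 240 120 15 x ρ := by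
  obtain ⟨s, hs₀, hs₁, rfl⟩ := exists_eq_add_mul (by norm_num) hx₀ hx₁
  obtain ⟨τ, hτ₀, hτ₁, rfl⟩ := exists_eq_add_mul (by norm_num) hρ₀ hρ₁
  refine nonneg_of_mul_eq_bernTable (K := 30000000) (by norm_num) hs₀ hs₁ hτ₀ hτ₁
    [[6890027861, 18837696100, 16629680000, 5220000000], [4407488222, 16583568700, 20492904000,
     9392800000], [48637961, 2808227800, 6394401600, 4172800000]] ?_
  simp only [outerBound,
    bernTable, bernForm, List.map_cons, List.map_nil, List.length_cons, List.length_nil,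
    Nat.reduceAdd, Nat.cast_ofNat]
  ring

theorem outerBound_far_right {x ρ : ℝ} (hx₀ : 93 / 200 ≤ x) (hx₁ : x ≤ 1)
    (hρ₀ : 8649 / 40000 ≤ ρ) (hρ₁ : ρ ≤ 1) :
    0 ≤ 357 - outerBound 330 70 35 x ρ := by
  obtain ⟨s, hs₀, hs₁, rfl⟩ := exists_eq_add_mul (by norm_num) hx₀ hx₁
  obtain ⟨τ, hτ₀, hτ₁, rfl⟩ := exists_eq_add_mul (by norm_num) hρ₀ hρ₁
  refine nonneg_of_mul_eq_bernTable (K := 288750000000000) (by norm_num) hs₀ hs₁ hτ₀ hτ₁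
    [[184996906086611, 26774837583307200, 73354004360040000, 51047370000000000],
     [17687608977651022, 78588001438012200, 151709849826000000, 99375870000000000],
     [30768945730604411, 78345831172785000, 91622179125000000, 48328500000000000]] ?_
  simp only [outerBound,
    bernTable, bernForm, List.map_cons, List.map_nil, List.length_cons, List.length_nil,
    Nat.reduceAdd, Nat.cast_ofNat]
  ring

/-- The term `140 * (ρ - x ^ 2 - 23 / 100)` is nonnegative where `(Im a)² ≥ 23 / 100`; without it
some Bernstein coefficients would be negative. -/
theorem outerBound_top_left {x ρ : ℝ} (hx₀ : -3 / 20 ≤ x) (hx₁ : x ≤ 4 / 25)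
    (hρ₀ : 23 / 100 ≤ ρ) (hρ₁ : ρ ≤ 1) :
    0 ≤ 357 - outerBound 290 120 30 x ρ - 140 * (ρ - x ^ 2 - 23 / 100) := by
  obtain ⟨s, hs₀, hs₁, rfl⟩ := exists_eq_add_mul (by norm_num) hx₀ hx₁
  obtain ⟨τ, hτ₀, hτ₁, rfl⟩ := exists_eq_add_mul (by norm_num) hρ₀ hρ₁
  refine nonneg_of_mul_eq_bernTable (K := 27187500) (by norm_num) hs₀ hs₁ hτ₀ hτ₁
    [[726783529, 2837339150, 4001423225, 2124612500], [181975268, 2354489330, 5427210520,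
     3722186250], [61314620, 1095176567, 2763471426, 1963354375]] ?_
  simp only [outerBound,
    bernTable, bernForm, List.map_cons, List.map_nil, List.length_cons, List.length_nil,
    Nat.reduceAdd, Nat.cast_ofNat]
  ring

theorem outerBound_top_right {x ρ : ℝ} (hx₀ : 4 / 25 ≤ x) (hx₁ : x ≤ 93 / 200)
    (hρ₀ : 1 / 4 ≤ ρ) (hρ₁ : ρ ≤ 1) :
    0 ≤ 357 - outerBound 300 120 35 x ρ - 140 * (ρ - x ^ 2 - 23 / 100) := by
  obtain ⟨s, hs₀, hs₁, rfl⟩ := exists_eq_add_mul (by norm_num) hx₀ hx₁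
  obtain ⟨τ, hτ₀, hτ₁, rfl⟩ := exists_eq_add_mul (by norm_num) hρ₀ hρ₁
  refine nonneg_of_mul_eq_bernTable (K := 350000) (by norm_num) hs₀ hs₁ hτ₀ hτ₁
    [[1144776, 17761312, 41123336, 27278800], [2207568, 35290336, 84999968, 57461200], [8538281,
     37038227, 60468571, 34740625]] ?_
  simp only [outerBound,
    bernTable, bernForm, List.map_cons, List.map_nil, List.length_cons, List.length_nil,
    Nat.reduceAdd, Nat.cast_ofNat]
  ring

/-! ### The sharp inequality in the Schur parameters -/

/-- The coefficient of `-(1 - |a|²) b²` in `2304 H`, where `H` is the Hankel determinant and `a`,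
`b` are the first two Schur parameters. -/
noncomputable def alphaC (a : ℂ) : ℂ :=
  256 + 144 * (starRingEnd ℂ) a + 32 * ((Complex.normSq a : ℝ) : ℂ)

/-- The coefficient of `-(1 - |a|²) b` in `2304 H`. -/
def betaC (a : ℂ) : ℂ := 112 - 64 * a - 64 * a ^ 2

/-- The value of `2304 H` for `b = 0` and third Schur parameter `0`. -/
def constC (a : ℂ) : ℂ := 11 + 56 * a - 8 * a ^ 2 + 16 * a ^ 3 + 80 * a ^ 4

theorem defect_eq (a : ℂ) : defect a.re (a.im ^ 2) = 1 - Complex.normSq a := by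
  simp only [defect, Complex.normSq_apply]
  ring

theorem alphaC_re (a : ℂ) : (alphaC a).re = alphaRe a.re (a.im ^ 2) := by
  simp [alphaC, alphaRe, Complex.normSq_apply]
  ring

theorem alphaC_im (a : ℂ) : (alphaC a).im = -(144 * a.im) := by
  simp [alphaC]

theorem betaC_re (a : ℂ) : (betaC a).re = betaRe a.re (a.im ^ 2) := by
  simp [betaC, betaRe, pow_succ]

theorem betaC_im (a : ℂ) : (betaC a).im = -(a.im * (64 + 128 * a.re)) := by
  simp [betaC, pow_succ]
  ring

theorem constC_re (a : ℂ) : (constC a).re = constRe a.re (a.im ^ 2) := by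
  simp [constC, constRe, pow_succ]
  ring

theorem constC_im (a : ℂ) : (constC a).im = a.im * constIm a.re (a.im ^ 2) := by
  simp [constC, constIm, pow_succ]
  ring

theorem majorantForm_eq (M δ : ℝ) (a z w : ℂ) :
    majorantForm M δ a.re a.im z.re (z.re - w.re) z.im w.im
      = (M - (halfBeta a.re (a.im ^ 2) - constRe a.re (a.im ^ 2) + δ)) * Complex.normSq z
        + (halfBeta a.re (a.im ^ 2) - constRe a.re (a.im ^ 2) + δ) * Complex.normSq w
        - ((defect a.re (a.im ^ 2) : ℂ) * alphaC a * z ^ 2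
            + (defect a.re (a.im ^ 2) : ℂ) * betaC a * (z * w) - constC a * w ^ 2).re := by
  simp only [Complex.add_re, Complex.sub_re, Complex.mul_re, Complex.mul_im, Complex.ofReal_re,
    Complex.ofReal_im, pow_two z, pow_two w, alphaC_re, alphaC_im, betaC_re, betaC_im, constC_re,
    constC_im, Complex.normSq_apply]
  simp only [majorantForm, topRe, halfBeta, betaIm, mixIm]
  ring

/-- A complex number becomes its own modulus after multiplication by the square of a unimodular
number. -/
theorem exists_sq_mul_eq_norm (Z : ℂ) :
    ∃ g : ℂ, Complex.normSq g = 1 ∧ g ^ 2 * Z = (‖Z‖ : ℂ) := by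
  by_cases hZ : Z = 0
  · exact ⟨1, by simp, by simp [hZ]⟩
  have hn : (‖Z‖ : ℂ) ≠ 0 := by simpa using hZ
  obtain ⟨g, hg⟩ := IsAlgClosed.exists_pow_nat_eq ((‖Z‖ : ℂ) / Z) (n := 2) (by norm_num)
  refine ⟨g, ?_, by rw [hg]; field_simp⟩
  have h : ‖g‖ ^ 2 = 1 := by
    rw [← norm_pow, hg, norm_div, Complex.norm_real, norm_norm, div_self (norm_ne_zero_iff.2 hZ)]
  rw [Complex.normSq_eq_norm_sq, h]

/-- If the form is positive semidefinite, then its value at `(z, w) = (b g, g)`, with `g` unimodular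
chosen so that the trinomial becomes its own modulus, bounds the trinomial by the two weights. -/
theorem norm_trinomial_le {M δ : ℝ} {a : ℂ}
    (h : ∀ p e u v, 0 ≤ majorantForm M δ a.re a.im p e u v) (b : ℂ) :
    ‖(defect a.re (a.im ^ 2) : ℂ) * alphaC a * b ^ 2
        + (defect a.re (a.im ^ 2) : ℂ) * betaC a * b - constC a‖
      ≤ (M - (halfBeta a.re (a.im ^ 2) - constRe a.re (a.im ^ 2) + δ)) * Complex.normSq b
        + (halfBeta a.re (a.im ^ 2) - constRe a.re (a.im ^ 2) + δ) := by
  obtain ⟨g, hg, hgZ⟩ := exists_sq_mul_eq_norm ((defect a.re (a.im ^ 2) : ℂ) * alphaC a * b ^ 2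
        + (defect a.re (a.im ^ 2) : ℂ) * betaC a * b - constC a)
  have h1 := h (b * g).re ((b * g).re - g.re) (b * g).im g.im
  rw [majorantForm_eq, Complex.normSq_mul, hg] at h1
  have h2 := congrArg Complex.re hgZ
  rw [Complex.ofReal_re] at h2
  rw [← h2]
  have h3 : (defect a.re (a.im ^ 2) : ℂ) * alphaC a * (b * g) ^ 2
            + (defect a.re (a.im ^ 2) : ℂ) * betaC a * (b * g * g) - constC a * g ^ 2
      = g ^ 2 * ((defect a.re (a.im ^ 2) : ℂ) * alphaC a * b ^ 2
        + (defect a.re (a.im ^ 2) : ℂ) * betaC a * b - constC a) := by ring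
  rw [h3] at h1
  linarith

theorem norm_le_sq_add_sq_div (z : ℂ) {m : ℝ} (hm : 0 < m) :
    ‖z‖ ≤ (Complex.normSq z + m ^ 2) / (2 * m) := by
  rw [le_div_iff₀ (by positivity), Complex.normSq_eq_norm_sq]
  nlinarith [sq_nonneg (‖z‖ - m)]

theorem norm_constC_le {a : ℂ} {m : ℝ} (hm : 0 < m) :
    ‖constC a‖ ≤ (121 + 1232 * a.re + 3136 * Complex.normSq a + m ^ 2) / (2 * m)
      + 8 * Complex.normSq a + 16 * (Complex.normSq a * (Complex.normSq a + 1 / 4))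
      + 80 * Complex.normSq a ^ 2 := by
  have h1 : ‖constC a‖ ≤ ‖(11 + 56 * a : ℂ)‖ + 8 * ‖a‖ ^ 2 + 16 * ‖a‖ ^ 3 + 80 * ‖a‖ ^ 4 := by
    unfold constC
    refine (norm_add_le _ _).trans (add_le_add ((norm_add_le _ _).trans (add_le_add
      ((norm_sub_le _ _).trans (add_le_add le_rfl ?_)) ?_)) ?_) <;> simp
  have h2 := norm_le_sq_add_sq_div (11 + 56 * a) hm
  have h3 : Complex.normSq (11 + 56 * a) = 121 + 1232 * a.re + 3136 * Complex.normSq a := by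
    simp [Complex.normSq_apply]
    ring
  rw [h3] at h2
  have h4 : ‖a‖ ^ 3 ≤ ‖a‖ ^ 2 * (‖a‖ ^ 2 + 1 / 4) := by
    nlinarith [mul_nonneg (sq_nonneg ‖a‖) (sq_nonneg (‖a‖ - 1 / 2))]
  rw [Complex.normSq_eq_norm_sq] at h2 ⊢
  nlinarith

theorem triangle_le_outerBound {a : ℂ} (ha : Complex.normSq a ≤ 1) {m₁ m₂ m₃ : ℝ} (h₁ : 0 < m₁)
    (h₂ : 0 < m₂) (h₃ : 0 < m₃) :
    ‖constC a‖ + (1 - Complex.normSq a) * (‖alphaC a‖ + ‖betaC a‖)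
      ≤ outerBound m₁ m₂ m₃ a.re (Complex.normSq a) := by
  have hα : Complex.normSq (alphaC a) = 65536 + 73728 * a.re + 37120 * Complex.normSq a
      + 9216 * a.re * Complex.normSq a + 1024 * Complex.normSq a ^ 2 := by
    rw [Complex.normSq_apply (alphaC a), alphaC_re, alphaC_im]
    simp only [alphaRe, Complex.normSq_apply]
    ring
  have hβ : Complex.normSq (betaC a) = 12544 + 4096 * Complex.normSq a
      + 4096 * Complex.normSq a ^ 2 - 14336 * a.re - 14336 * (2 * a.re ^ 2 - Complex.normSq a)
      + 8192 * Complex.normSq a * a.re := by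
    rw [Complex.normSq_apply (betaC a), betaC_re, betaC_im]
    simp only [betaRe, Complex.normSq_apply]
    ring
  have h4 := norm_le_sq_add_sq_div (alphaC a) h₁
  have h5 := norm_le_sq_add_sq_div (betaC a) h₂
  rw [hα] at h4
  rw [hβ] at h5
  have h6 := mul_le_mul_of_nonneg_left (add_le_add h4 h5) (sub_nonneg.2 ha)
  have h7 := norm_constC_le (a := a) h₃
  unfold outerBound
  linarith

/-- Outside the inner region the triangle inequality suffices, with room to spare below the sharp
constant `357.36…`. -/
theorem outerBound_le {a : ℂ} (ha : Complex.normSq a ≤ 1)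
    (h : a.re ≤ -3 / 20 ∨ 93 / 200 ≤ a.re ∨ 23 / 100 ≤ a.im ^ 2) :
    ‖constC a‖ + (1 - Complex.normSq a) * (‖alphaC a‖ + ‖betaC a‖) ≤ 357 := by
  have hρ : Complex.normSq a = a.re ^ 2 + a.im ^ 2 := by
    rw [Complex.normSq_apply]; ring
  have hy := sq_nonneg a.im
  have hx1 : a.re ≤ 1 := by nlinarith
  have hx2 : -1 ≤ a.re := by nlinarith
  by_cases h1 : a.re ≤ -3 / 20
  · have := outerBound_left (x := a.re) (ρ := Complex.normSq a) (by linarith) h1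
      (by nlinarith) ha
    linarith [triangle_le_outerBound ha (m₁ := 240) (m₂ := 120) (m₃ := 15) (by norm_num)
      (by norm_num) (by norm_num)]
  by_cases h2 : 93 / 200 ≤ a.re
  · have := outerBound_far_right (x := a.re) (ρ := Complex.normSq a) h2 hx1 (by nlinarith) ha
    linarith [triangle_le_outerBound ha (m₁ := 330) (m₂ := 70) (m₃ := 35) (by norm_num)
      (by norm_num) (by norm_num)]
  have h3 : 23 / 100 ≤ a.im ^ 2 := by tauto
  push Not at h1 h2
  rcases le_total a.re (4 / 25) with h4 | h4
  · have := outerBound_top_left (x := a.re) (ρ := Complex.normSq a) h1.le h4 (by nlinarith) ha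
    linarith [triangle_le_outerBound ha (m₁ := 290) (m₂ := 120) (m₃ := 30) (by norm_num)
      (by norm_num) (by norm_num)]
  · have := outerBound_top_right (x := a.re) (ρ := Complex.normSq a) h4 h2.le (by nlinarith) ha
    linarith [triangle_le_outerBound ha (m₁ := 300) (m₂ := 120) (m₃ := 35) (by norm_num)
      (by norm_num) (by norm_num)]

/-- This makes the triangle inequality bound increasing in `|b|²`, so that `|b| = 1` is its worst
case. -/
theorem norm_one_add_two_mul_le {a : ℂ} (ha : Complex.normSq a ≤ 1) :
    144 * ‖1 + 2 * a‖ ≤ ‖alphaC a‖ := by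
  have hρ : Complex.normSq a = a.re ^ 2 + a.im ^ 2 := by
    rw [Complex.normSq_apply]; ring
  have hy := sq_nonneg a.im
  have hx1 : a.re ≤ 1 := by nlinarith
  have h1 : Complex.normSq (1 + 2 * a) = 1 + 4 * a.re + 4 * Complex.normSq a := by
    simp [Complex.normSq_apply]
    ring
  have h2 : Complex.normSq (alphaC a) - 144 ^ 2 * Complex.normSq (1 + 2 * a)
      = (1 - Complex.normSq a) * (44800 - 9216 * a.re - 1024 * Complex.normSq a) := by
    rw [h1, Complex.normSq_apply (alphaC a), alphaC_re, alphaC_im]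
    simp only [alphaRe, Complex.normSq_apply]
    ring
  have h3 : 0 ≤ (1 - Complex.normSq a) * (44800 - 9216 * a.re - 1024 * Complex.normSq a) :=
    mul_nonneg (by linarith) (by linarith)
  rw [← h2, Complex.normSq_eq_norm_sq, Complex.normSq_eq_norm_sq] at h3
  refine le_of_sq_le_sq ?_ (norm_nonneg _)
  linarith

/-- The bound for all Schur parameters `a`, `b` of modulus at most one. -/
theorem norm_trinomial_add_le {M : ℝ} (hM : 178682299 / 500000 ≤ M)
    (hgap : ∀ x : ℝ, -3 / 20 ≤ x → x ≤ 9 / 250 →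
      -48 * x ^ 4 - 96 * x ^ 3 - 392 * x ^ 2 + 24 * x + 357
        + (23 / 200 * (24 - 784 * x - 288 * x ^ 2 - 192 * x ^ 3)) ^ 2 / 32 ≤ M)
    {a b : ℂ} (ha : ‖a‖ ≤ 1) (hb : ‖b‖ ≤ 1) :
    ‖constC a - (1 - Complex.normSq a : ℝ) * betaC a * b
        - (1 - Complex.normSq a : ℝ) * alphaC a * b ^ 2‖
      + 144 * (1 - Complex.normSq a) * ‖1 + 2 * a‖ * (1 - Complex.normSq b) ≤ M := by
  have ha' : Complex.normSq a ≤ 1 := by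
    rw [Complex.normSq_eq_norm_sq]; nlinarith [norm_nonneg a]
  have hb' : Complex.normSq b ≤ 1 := by
    rw [Complex.normSq_eq_norm_sq]; nlinarith [norm_nonneg b]
  have hρ : Complex.normSq a = a.re ^ 2 + a.im ^ 2 := by
    rw [Complex.normSq_apply]; ring
  set r : ℝ := 1 - Complex.normSq a with hr
  have hr0 : 0 ≤ r := by linarith
  by_cases hin : -3 / 20 < a.re ∧ a.re < 93 / 200 ∧ a.im ^ 2 < 23 / 100
  · obtain ⟨h1, h2, h3⟩ := hin
    obtain ⟨δ, hform, hweight⟩ := exists_majorantForm_nonneg (M := M) (x := a.re) (y := a.im) hM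
      ((le_total a.re (9 / 250)).imp (hgap _ h1.le) id) h1.le h2.le h3.le
    have h4 := norm_trinomial_le hform b
    rw [defect_eq, ← hr] at h4 hweight
    have h5 : ‖constC a - (r : ℂ) * betaC a * b - (r : ℂ) * alphaC a * b ^ 2‖
        = ‖(r : ℂ) * alphaC a * b ^ 2 + (r : ℂ) * betaC a * b - constC a‖ := by
      rw [← norm_neg]; congr 1; ring
    rw [h5]
    have h6 : ‖1 + 2 * a‖ ≤ 5 / 4 + a.re + (a.re ^ 2 + a.im ^ 2) := by
      refine (norm_le_sq_add_sq_div (1 + 2 * a) (m := 2) (by norm_num)).trans_eq ?_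
      simp [Complex.normSq_apply]
      ring
    have h7 := mul_le_mul_of_nonneg_right
      ((mul_le_mul_of_nonneg_left (mul_le_mul_of_nonneg_left h6 hr0)
        (by norm_num : (0 : ℝ) ≤ 144)).trans hweight) (sub_nonneg.2 hb')
    linarith
  · have h4 := outerBound_le ha' (by
      by_contra! h
      exact hin ⟨h.1, h.2.1, h.2.2⟩)
    have h5 : ‖constC a - (r : ℂ) * betaC a * b - (r : ℂ) * alphaC a * b ^ 2‖
        ≤ ‖constC a‖ + r * ‖betaC a‖ + r * ‖alphaC a‖ * Complex.normSq b := by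
      refine (norm_sub_le _ _).trans (add_le_add ((norm_sub_le _ _).trans
        (add_le_add le_rfl ?_)) ?_)
      · rw [norm_mul, norm_mul, Complex.norm_real, Real.norm_of_nonneg hr0]
        exact mul_le_of_le_one_right (by positivity) hb
      · rw [norm_mul, norm_mul, Complex.norm_real, Real.norm_of_nonneg hr0, norm_pow,
          Complex.normSq_eq_norm_sq]
    have h6 := mul_le_mul_of_nonneg_right
      (mul_le_mul_of_nonneg_left (norm_one_add_two_mul_le ha') hr0) (sub_nonneg.2 hb')
    linarith

/-! ### The critical point of `X` -/

theorem deriv_quarticX (x : ℝ) :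
    deriv quarticX x = 24 - 784 * x - 288 * x ^ 2 - 192 * x ^ 3 := by
  have h : HasDerivAt quarticX (-48 * (4 * x ^ 3) - 96 * (3 * x ^ 2) - 392 * (2 * x) + 24) x := by
    unfold quarticX
    simpa using (((((hasDerivAt_pow 4 x).const_mul (-48)).sub
      ((hasDerivAt_pow 3 x).const_mul 96)).sub ((hasDerivAt_pow 2 x).const_mul 392)).add
      ((hasDerivAt_id x).const_mul 24)).add_const 357
  rw [h.deriv]
  ring

theorem exists_critical_point :
    ∃ η : ℝ, (∀ x : ℝ, deriv quarticX x = 0 ↔ x = η) ∧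
      0.030268875 < η ∧ η < 0.030268925 := by
  have hc : ContinuousOn (fun x : ℝ => 24 - 784 * x - 288 * x ^ 2 - 192 * x ^ 3)
      (Set.Icc 0.030268875 0.030268925) := by fun_prop
  obtain ⟨η, ⟨h1, h2⟩, h3⟩ := intermediate_value_Ioo' (by norm_num) hc
    (show (0 : ℝ) ∈ _ by constructor <;> norm_num)
  refine ⟨η, fun x => ?_, h1, h2⟩
  rw [deriv_quarticX]
  constructor
  · intro hx
    have h4 : (x - η) * (784 + 288 * (x + η) + 192 * (x ^ 2 + x * η + η ^ 2)) = 0 := by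
      simp only at h3
      linear_combination h3 - hx
    rcases mul_eq_zero.1 h4 with h | h
    · linarith
    · nlinarith [sq_nonneg (x + η + 3 / 2), sq_nonneg x, sq_nonneg η]
  · rintro rfl
    exact h3

/-- `X` expanded at its critical point: it has a strict quadratic maximum there. -/
theorem quarticX_sub {η : ℝ} (hη : deriv quarticX η = 0) (x : ℝ) :
    quarticX η - quarticX x = (x - η) ^ 2
      * (48 * x ^ 2 + 96 * x * η + 144 * η ^ 2 + 96 * x + 192 * η + 392) := by
  rw [deriv_quarticX] at hη
  unfold quarticX
  linear_combination (η - x) * hη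

/-- A rational lower bound, from the value of `X` at `0.03027`. -/
theorem le_quarticX_critical {η : ℝ} (hη : deriv quarticX η = 0) (h₀ : 0.0302 < η) :
    178682299 / 500000 ≤ quarticX η := by
  have h := quarticX_sub hη (3027 / 100000)
  have h2 : 178682299 / 500000 ≤ quarticX (3027 / 100000) := by
    unfold quarticX; norm_num
  have : 0 ≤ quarticX η - quarticX (3027 / 100000) := by
    rw [h]
    norm_num at h₀
    positivity
  linarith

/-- Both `X η - X x` and `(deriv X x) ^ 2` are of the order of `(x - η) ^ 2`; the constants leave
room for the loss caused by the choice of `δ` as a multiple of the derivative. -/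
theorem quarticX_gap {η : ℝ} (hη : deriv quarticX η = 0) (h₀ : 0.0302 < η) (h₁ : η < 0.0303)
    (x : ℝ) (hx₀ : -3 / 20 ≤ x) (hx₁ : x ≤ 9 / 250) :
    -48 * x ^ 4 - 96 * x ^ 3 - 392 * x ^ 2 + 24 * x + 357
        + (23 / 200 * (24 - 784 * x - 288 * x ^ 2 - 192 * x ^ 3)) ^ 2 / 32 ≤ quarticX η := by
  norm_num at h₀ h₁
  have h := quarticX_sub hη x
  rw [deriv_quarticX] at hη
  have h2 : 24 - 784 * x - 288 * x ^ 2 - 192 * x ^ 3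
      = -((x - η) * (784 + 288 * (x + η) + 192 * (x ^ 2 + x * η + η ^ 2))) := by
    linear_combination hη
  have h3 : 784 + 288 * (x + η) + 192 * (x ^ 2 + x * η + η ^ 2) ≤ 850 := by nlinarith
  have h4 : 0 ≤ 784 + 288 * (x + η) + 192 * (x ^ 2 + x * η + η ^ 2) := by
    nlinarith [sq_nonneg (x + η / 2)]
  have h5 : (784 + 288 * (x + η) + 192 * (x ^ 2 + x * η + η ^ 2)) ^ 2 ≤ 850 ^ 2 :=
    pow_le_pow_left₀ h4 h3 2
  have h6 : 370 ≤ 48 * x ^ 2 + 96 * x * η + 144 * η ^ 2 + 96 * x + 192 * η + 392 := by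
    nlinarith [sq_nonneg (x + η)]
  have h7 := mul_le_mul_of_nonneg_left h5 (sq_nonneg (x - η))
  have h8 := mul_le_mul_of_nonneg_left h6 (sq_nonneg (x - η))
  have h9 : quarticX x = -48 * x ^ 4 - 96 * x ^ 3 - 392 * x ^ 2 + 24 * x + 357 := rfl
  rw [← h9, h2]
  nlinarith [sq_nonneg (x - η)]

/-! ### Taylor coefficients at the origin -/

/-- The `n`-th Taylor coefficient of `f` at `0`. -/
noncomputable def taylorCoeff (f : ℂ → ℂ) (n : ℕ) : ℂ :=
  iteratedDeriv n f 0 / (n.factorial : ℂ)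

open Filter Topology in
theorem taylorCoeff_congr {f g : ℂ → ℂ} (h : f =ᶠ[𝓝 0] g) (n : ℕ) :
    taylorCoeff f n = taylorCoeff g n := by
  rw [taylorCoeff, taylorCoeff, h.iteratedDeriv_eq]

theorem taylorCoeff_zero (f : ℂ → ℂ) : taylorCoeff f 0 = f 0 := by
  simp [taylorCoeff]

theorem taylorCoeff_add {f g : ℂ → ℂ} (hf : AnalyticAt ℂ f 0) (hg : AnalyticAt ℂ g 0) (n : ℕ) :
    taylorCoeff (fun z => f z + g z) n = taylorCoeff f n + taylorCoeff g n := by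
  simp only [taylorCoeff]
  rw [iteratedDeriv_fun_add hf.contDiffAt hg.contDiffAt, add_div]

theorem taylorCoeff_sub {f g : ℂ → ℂ} (hf : AnalyticAt ℂ f 0) (hg : AnalyticAt ℂ g 0) (n : ℕ) :
    taylorCoeff (fun z => f z - g z) n = taylorCoeff f n - taylorCoeff g n := by
  simp only [taylorCoeff]
  rw [iteratedDeriv_fun_sub hf.contDiffAt hg.contDiffAt, sub_div]

theorem taylorCoeff_const_succ (c : ℂ) (n : ℕ) : taylorCoeff (fun _ => c) (n + 1) = 0 := by
  simp [taylorCoeff, iteratedDeriv_const]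

theorem taylorCoeff_const_mul (c : ℂ) (f : ℂ → ℂ) (n : ℕ) :
    taylorCoeff (fun z => c * f z) n = c * taylorCoeff f n := by
  simp only [taylorCoeff, iteratedDeriv_const_mul_field, mul_div_assoc]

theorem taylorCoeff_deriv (f : ℂ → ℂ) (n : ℕ) :
    taylorCoeff (deriv f) n = (n + 1) * taylorCoeff f (n + 1) := by
  have h1 : ((n : ℂ) + 1) ≠ 0 := by exact_mod_cast n.succ_ne_zero
  have h2 : (n.factorial : ℂ) ≠ 0 := by exact_mod_cast n.factorial_ne_zero
  rw [taylorCoeff, taylorCoeff, ← iteratedDeriv_succ', Nat.factorial_succ]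
  push_cast
  field_simp

/-- The Taylor coefficients of a product are given by the Cauchy product. -/
theorem taylorCoeff_mul {f g : ℂ → ℂ} (hf : AnalyticAt ℂ f 0) (hg : AnalyticAt ℂ g 0) (n : ℕ) :
    taylorCoeff (fun z => f z * g z) n
      = ∑ i ∈ Finset.range (n + 1), taylorCoeff f i * taylorCoeff g (n - i) := by
  simp only [taylorCoeff]
  rw [iteratedDeriv_fun_mul hf.contDiffAt hg.contDiffAt, Finset.sum_div]
  refine Finset.sum_congr rfl fun i hi => ?_
  have hi' : i ≤ n := Nat.lt_succ_iff.1 (Finset.mem_range.1 hi)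
  have h1 : (i.factorial : ℂ) ≠ 0 := by exact_mod_cast i.factorial_ne_zero
  have h2 : ((n - i).factorial : ℂ) ≠ 0 := by exact_mod_cast (n - i).factorial_ne_zero
  have h3 : (n.factorial : ℂ) ≠ 0 := by exact_mod_cast n.factorial_ne_zero
  rw [Nat.choose_eq_factorial_div_factorial hi',
    Nat.cast_div (Nat.factorial_mul_factorial_dvd_factorial hi') (by push_cast; positivity)]
  push_cast
  field_simp

theorem taylorCoeff_id_mul_succ {f : ℂ → ℂ} (hf : AnalyticAt ℂ f 0) (n : ℕ) :
    taylorCoeff (fun z => z * f z) (n + 1) = taylorCoeff f n := by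
  have hid : AnalyticAt ℂ (fun z : ℂ => z) 0 := by fun_prop
  have h0 : taylorCoeff (fun z : ℂ => z) 0 = 0 := by simp [taylorCoeff]
  have h1 : taylorCoeff (fun z : ℂ => z) 1 = 1 := by simp [taylorCoeff]
  have h2 : ∀ k, taylorCoeff (fun z : ℂ => z) (k + 1 + 1) = 0 := fun k => by
    have : deriv (fun z : ℂ => z) = fun _ => 1 := by ext z; simp
    simp [taylorCoeff, iteratedDeriv_succ', this, iteratedDeriv_const]
  rw [taylorCoeff_mul hid hf, Finset.sum_range_succ', Finset.sum_range_succ',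
    Finset.sum_eq_zero fun k _ => by rw [h2, zero_mul]]
  simp [h0, h1]

/-! ### The Hankel determinant in terms of the Carathéodory coefficients -/

theorem analyticAt_dslope {f : ℂ → ℂ} (hf : AnalyticAt ℂ f 0) :
    AnalyticAt ℂ (dslope f 0) 0 :=
  let ⟨_, hp⟩ := hf
  hp.has_fpower_series_dslope_fslope.analyticAt

theorem eq_id_mul_dslope {f : ℂ → ℂ} (h0 : f 0 = 0) (z : ℂ) : f z = z * dslope f 0 z := by
  simpa [h0] using (sub_smul_dslope f 0 z).symm

theorem taylorCoeff_dslope {f : ℂ → ℂ} (hf : AnalyticAt ℂ f 0) (h0 : f 0 = 0) (n : ℕ) :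
    taylorCoeff (dslope f 0) n = taylorCoeff f (n + 1) := by
  rw [← taylorCoeff_id_mul_succ (analyticAt_dslope hf), ← funext (eq_id_mul_dslope h0)]

/-- The relation `g (log g)' = g'` between the first Taylor coefficients of `g` and `log g`. -/
theorem taylorCoeff_log {g : ℂ → ℂ} (hg : AnalyticAt ℂ g 0) (h1 : g 0 = 1) :
    let l := taylorCoeff (fun z => Complex.log (g z))
    l 1 = taylorCoeff g 1 ∧
    2 * l 2 = 2 * taylorCoeff g 2 - taylorCoeff g 1 * l 1 ∧
    3 * l 3 = 3 * taylorCoeff g 3 - 2 * taylorCoeff g 1 * l 2 - taylorCoeff g 2 * l 1 := by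
  intro l
  have hs : g 0 ∈ Complex.slitPlane := by simp [h1]
  have hL : AnalyticAt ℂ (fun z => Complex.log (g z)) 0 := hg.clog hs
  have hev : deriv g =ᶠ[nhds 0] fun z => g z * deriv (fun z => Complex.log (g z)) z := by
    filter_upwards [hg.eventually_analyticAt,
      hg.continuousAt.eventually (Complex.isOpen_slitPlane.mem_nhds hs)] with z hz hz'
    rw [(hz.differentiableAt.hasDerivAt.clog hz').deriv,
      mul_div_cancel₀ _ (Complex.slitPlane_ne_zero hz')]
  have key : ∀ n : ℕ, (n + 1) * taylorCoeff g (n + 1) =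
      ∑ i ∈ Finset.range (n + 1), taylorCoeff g i * (((n - i : ℕ) + 1) * l (n - i + 1)) := by
    intro n
    rw [← taylorCoeff_deriv, taylorCoeff_congr hev, taylorCoeff_mul hg hL.deriv]
    simp only [taylorCoeff_deriv, l]
  have k0 := key 0
  have k1 := key 1
  have k2 := key 2
  simp [Finset.sum_range_succ, taylorCoeff_zero, h1] at k0 k1 k2
  refine ⟨k0.symm, ?_, ?_⟩
  · linear_combination -k1
  · linear_combination -k2

theorem taylorCoeff_one_sub_mul_deriv {f : ℂ → ℂ} (hf : AnalyticAt ℂ f 0) (n : ℕ) :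
    taylorCoeff (fun z => (1 - z) * deriv f z) (n + 1)
      = (n + 2) * taylorCoeff f (n + 2) - (n + 1) * taylorCoeff f (n + 1) := by
  have hd := hf.deriv
  have he : (fun z => (1 - z) * deriv f z) = fun z => deriv f z - z * deriv f z := by
    ext z; ring
  have hid : AnalyticAt ℂ (fun z => z * deriv f z) 0 := by fun_prop
  rw [he, taylorCoeff_sub hd hid, taylorCoeff_id_mul_succ hd, taylorCoeff_deriv,
    taylorCoeff_deriv]
  push_cast
  ring

/-- The Hankel determinant as a polynomial in the first three Taylor coefficients of
`p z = (1 - z) f' z`. -/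
theorem logHankel_eq {f : ℂ → ℂ} (hf : AnalyticAt ℂ f 0) (h0 : f 0 = 0) (h1 : deriv f 0 = 1)
    {p : ℂ → ℂ} (hp : p = fun z => (1 - z) * deriv f z) :
    2304 * logHankel 2 1 f =
      72 * (1 + taylorCoeff p 1) * (1 + taylorCoeff p 1 + taylorCoeff p 2 + taylorCoeff p 3)
        - 64 * (1 + taylorCoeff p 1 + taylorCoeff p 2) ^ 2 + 3 * (1 + taylorCoeff p 1) ^ 4 := by
  have hg1 : dslope f 0 0 = 1 := by rw [dslope_same, h1]
  obtain ⟨l1, l2, l3⟩ := taylorCoeff_log (analyticAt_dslope hf) hg1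
  have hγ : ∀ n, logCoeff f n = taylorCoeff (fun z => Complex.log (dslope f 0 z)) n / 2 :=
    fun n => rfl
  have ha1 : taylorCoeff f 1 = 1 := by simp [taylorCoeff, h1]
  have c1 := taylorCoeff_one_sub_mul_deriv hf 0
  have c2 := taylorCoeff_one_sub_mul_deriv hf 1
  have c3 := taylorCoeff_one_sub_mul_deriv hf 2
  rw [← hp] at c1 c2 c3
  simp only [taylorCoeff_dslope hf h0] at l1 l2 l3
  norm_num [ha1] at l1 l2 l3 c1 c2 c3
  rw [logHankel, Matrix.det_fin_two]
  simp only [Matrix.of_apply, hγ, c1, c2, c3]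
  norm_num
  have l2' : taylorCoeff (fun z => Complex.log (dslope f 0 z)) 2
      = taylorCoeff f 3 - taylorCoeff f 2 ^ 2 / 2 := by
    rw [l1] at l2; linear_combination l2 / 2
  have l3' : taylorCoeff (fun z => Complex.log (dslope f 0 z)) 3
      = taylorCoeff f 4 - taylorCoeff f 2 * taylorCoeff f 3 + taylorCoeff f 2 ^ 3 / 3 := by
    rw [l1, l2'] at l3; linear_combination l3 / 3
  rw [l1, l2', l3']
  ring

/-! ### Schur parameters -/

/-- The Schur class: functions holomorphic on the open unit disc and bounded there by `1`. -/
def SchurClass (φ : ℂ → ℂ) : Prop :=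
  DifferentiableOn ℂ φ (Metric.ball 0 1) ∧ ∀ z ∈ Metric.ball (0 : ℂ) 1, ‖φ z‖ ≤ 1

theorem SchurClass.analyticAt_zero {φ : ℂ → ℂ} (h : SchurClass φ) : AnalyticAt ℂ φ 0 :=
  h.1.analyticAt (Metric.ball_mem_nhds 0 one_pos)

theorem SchurClass.norm_zero_le {φ : ℂ → ℂ} (h : SchurClass φ) : ‖φ 0‖ ≤ 1 :=
  h.2 0 (Metric.mem_ball_self one_pos)

/-- The Schwarz lemma: dividing a Schur function vanishing at `0` by `z` gives a Schur function. -/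
theorem SchurClass.dslope {ω : ℂ → ℂ} (h : SchurClass ω) (h0 : ω 0 = 0) :
    SchurClass (dslope ω 0) := by
  refine ⟨(Complex.differentiableOn_dslope (Metric.ball_mem_nhds 0 one_pos)).2 h.1,
    fun z hz => ?_⟩
  have hm : Set.MapsTo ω (Metric.ball 0 1) (Metric.closedBall (ω 0) 1) := fun w hw => by
    simpa [h0] using h.2 w hw
  simpa using Complex.norm_dslope_le_div_of_mapsTo_ball h.1 hm hz

theorem norm_sub_le_norm_one_sub_conj_mul {a w : ℂ} (ha : ‖a‖ ≤ 1) (hw : ‖w‖ ≤ 1) :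
    ‖w - a‖ ≤ ‖1 - (starRingEnd ℂ) a * w‖ := by
  have ha' : Complex.normSq a ≤ 1 := by
    rw [Complex.normSq_eq_norm_sq]; exact pow_le_one₀ (norm_nonneg _) ha
  have hw' : Complex.normSq w ≤ 1 := by
    rw [Complex.normSq_eq_norm_sq]; exact pow_le_one₀ (norm_nonneg _) hw
  -- the squared norms differ by `(1 - |a|²) (1 - |w|²)`
  have h := mul_nonneg (sub_nonneg.2 ha') (sub_nonneg.2 hw')
  rw [Complex.norm_def, Complex.norm_def]
  refine Real.sqrt_le_sqrt (sub_nonneg.1 (h.trans_eq ?_))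
  simp only [Complex.normSq_apply, Complex.sub_re, Complex.sub_im, Complex.mul_re, Complex.mul_im,
    Complex.conj_re, Complex.conj_im, Complex.one_re, Complex.one_im]
  ring

/-- One step of the Schur algorithm. -/
theorem SchurClass.exists_step {φ : ℂ → ℂ} (h : SchurClass φ) :
    ∃ ψ, SchurClass ψ ∧ ∀ z ∈ Metric.ball (0 : ℂ) 1,
      φ z - φ 0 = z * (ψ z * (1 - (starRingEnd ℂ) (φ 0) * φ z)) := by
  have h0 : (0 : ℂ) ∈ Metric.ball (0 : ℂ) 1 := Metric.mem_ball_self one_pos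
  rcases h.norm_zero_le.lt_or_eq with hlt | heq
  · have hne : ∀ z ∈ Metric.ball (0 : ℂ) 1, 1 - (starRingEnd ℂ) (φ 0) * φ z ≠ 0 := by
      intro z hz h1
      have h2 : ‖(starRingEnd ℂ) (φ 0) * φ z‖ < 1 := by
        rw [norm_mul, Complex.norm_conj]
        nlinarith [h.2 z hz, norm_nonneg (φ 0), norm_nonneg (φ z)]
      rw [← sub_eq_zero.1 h1, norm_one] at h2
      exact lt_irrefl _ h2
    set ω : ℂ → ℂ := fun z => (φ z - φ 0) / (1 - (starRingEnd ℂ) (φ 0) * φ z) with hω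
    have hω0 : ω 0 = 0 := by simp [hω]
    have hS : SchurClass ω := by
      refine ⟨(h.1.sub_const _).div ((h.1.const_mul _).const_sub _) hne, fun z hz => ?_⟩
      rw [hω, norm_div]
      exact div_le_one_of_le₀ (norm_sub_le_norm_one_sub_conj_mul h.norm_zero_le (h.2 z hz))
        (norm_nonneg _)
    refine ⟨_, hS.dslope hω0, fun z hz => ?_⟩
    rw [← mul_assoc, ← eq_id_mul_dslope hω0, hω, div_mul_cancel₀ _ (hne z hz)]
  · -- by the maximum modulus principle `φ` is constant
    have hc := Complex.eqOn_of_isPreconnected_of_isMaxOn_norm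
      (convex_ball (0 : ℂ) 1).isPreconnected Metric.isOpen_ball h.1 h0
      (fun z hz => by simpa [heq] using h.2 z hz)
    exact ⟨fun _ => 0, ⟨differentiableOn_const _, by simp⟩, fun z hz => by simp [hc hz]⟩

theorem taylorCoeff_schur_step {φ ψ : ℂ → ℂ} (hφ : SchurClass φ) (hψ : SchurClass ψ)
    (h : ∀ z ∈ Metric.ball (0 : ℂ) 1,
      φ z - φ 0 = z * (ψ z * (1 - (starRingEnd ℂ) (φ 0) * φ z))) :
    taylorCoeff φ 1 = (1 - Complex.normSq (φ 0)) * ψ 0 ∧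
    taylorCoeff φ 2 = (1 - Complex.normSq (φ 0)) *
      (taylorCoeff ψ 1 - (starRingEnd ℂ) (φ 0) * ψ 0 ^ 2) := by
  have hA := hφ.analyticAt_zero
  have hB := hψ.analyticAt_zero
  have hev : (fun z => φ z - φ 0) =ᶠ[nhds 0]
      fun z => z * (ψ z * (1 - (starRingEnd ℂ) (φ 0) * φ z)) :=
    Filter.eventually_of_mem (Metric.ball_mem_nhds 0 one_pos) h
  have hC : AnalyticAt ℂ (fun z => (starRingEnd ℂ) (φ 0) * φ z) 0 := by fun_prop
  have hD : AnalyticAt ℂ (fun z => 1 - (starRingEnd ℂ) (φ 0) * φ z) 0 := by fun_prop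
  have key : ∀ n, taylorCoeff φ (n + 1) = ∑ i ∈ Finset.range (n + 1), taylorCoeff ψ i *
      taylorCoeff (fun z => 1 - (starRingEnd ℂ) (φ 0) * φ z) (n - i) := by
    intro n
    rw [← taylorCoeff_mul hB hD, ← taylorCoeff_id_mul_succ (hB.fun_mul hD),
      ← taylorCoeff_congr hev, taylorCoeff_sub hA analyticAt_const, taylorCoeff_const_succ,
      sub_zero]
  have hD0 : taylorCoeff (fun z => 1 - (starRingEnd ℂ) (φ 0) * φ z) 0
      = 1 - Complex.normSq (φ 0) := by
    rw [taylorCoeff_zero, Complex.normSq_eq_conj_mul_self]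
  have hD1 : taylorCoeff (fun z => 1 - (starRingEnd ℂ) (φ 0) * φ z) 1
      = - ((starRingEnd ℂ) (φ 0) * taylorCoeff φ 1) := by
    rw [taylorCoeff_sub analyticAt_const hC, taylorCoeff_const_succ, taylorCoeff_const_mul,
      zero_sub]
  have k0 := key 0
  have k1 := key 1
  simp only [Finset.sum_range_succ, Finset.range_zero, Finset.sum_empty, zero_add, Nat.sub_zero,
    Nat.sub_self, hD0, hD1, taylorCoeff_zero] at k0 k1
  refine ⟨by rw [k0]; ring, ?_⟩
  rw [show (2 : ℕ) = 1 + 1 from rfl, k1, k0]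
  ring

/-- The first three Taylor coefficients of a Schur function in terms of its first three Schur
parameters `φ 0`, `b`, `ζ`. -/
theorem SchurClass.exists_parameters {φ : ℂ → ℂ} (h : SchurClass φ) :
    ∃ b ζ : ℂ, ‖b‖ ≤ 1 ∧ ‖ζ‖ ≤ 1 ∧
      taylorCoeff φ 1 = (1 - Complex.normSq (φ 0)) * b ∧
      taylorCoeff φ 2 = (1 - Complex.normSq (φ 0)) *
        ((1 - Complex.normSq b) * ζ - (starRingEnd ℂ) (φ 0) * b ^ 2) := by
  obtain ⟨ψ, hψ, hs⟩ := h.exists_step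
  obtain ⟨χ, hχ, ht⟩ := hψ.exists_step
  obtain ⟨h1, h2⟩ := taylorCoeff_schur_step h hψ hs
  refine ⟨ψ 0, χ 0, hψ.norm_zero_le, hχ.norm_zero_le, h1, ?_⟩
  rw [h2, (taylorCoeff_schur_step hψ hχ ht).1]

/-- The Cayley transform: a Carathéodory function is `(1 + z φ) / (1 - z φ)` with `φ` a Schur
function, which determines its first coefficients from those of `φ`. -/
theorem Caratheodory.exists_schur {p : ℂ → ℂ} (hp : Caratheodory p) :
    ∃ φ, SchurClass φ ∧ taylorCoeff p 1 = 2 * φ 0 ∧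
      taylorCoeff p 2 = φ 0 * taylorCoeff p 1 + 2 * taylorCoeff φ 1 ∧
      taylorCoeff p 3 = φ 0 * taylorCoeff p 2 + taylorCoeff φ 1 * taylorCoeff p 1
        + 2 * taylorCoeff φ 2 := by
  obtain ⟨han, hp0, hre⟩ := hp
  have hne : ∀ z ∈ Metric.ball (0 : ℂ) 1, p z + 1 ≠ 0 := fun z hz h => by
    have := congrArg Complex.re h
    simp at this
    linarith [hre z hz]
  set ω : ℂ → ℂ := fun z => (p z - 1) / (p z + 1) with hω
  have hω0 : ω 0 = 0 := by simp [hω, hp0]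
  have hS : SchurClass ω := by
    have hd := han.differentiableOn
    refine ⟨(hd.sub_const _).div (hd.add_const _) hne, fun z hz => ?_⟩
    rw [hω, norm_div]
    refine div_le_one_of_le₀ ?_ (norm_nonneg _)
    have := hre z hz
    rw [Complex.norm_def, Complex.norm_def]
    refine Real.sqrt_le_sqrt ?_
    simp only [Complex.normSq_apply, Complex.sub_re, Complex.sub_im, Complex.add_re,
      Complex.add_im, Complex.one_re, Complex.one_im]
    nlinarith
  have hφ := hS.dslope hω0
  refine ⟨_, hφ, ?_⟩
  set φ := _root_.dslope ω 0 with hφd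
  have hA := hφ.analyticAt_zero
  have hP : AnalyticAt ℂ p 0 := han 0 (Metric.mem_ball_self one_pos)
  have hQ : AnalyticAt ℂ (fun z => p z + 1) 0 := by fun_prop
  have hev : (fun z => p z - 1) =ᶠ[nhds 0] fun z => z * (φ z * (p z + 1)) := by
    filter_upwards [Metric.ball_mem_nhds (0 : ℂ) one_pos] with z hz
    rw [← mul_assoc, ← eq_id_mul_dslope hω0, hω, div_mul_cancel₀ _ (hne z hz)]
  have key : ∀ n, taylorCoeff p (n + 1) = ∑ i ∈ Finset.range (n + 1), taylorCoeff φ i *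
      taylorCoeff (fun z => p z + 1) (n - i) := by
    intro n
    rw [← taylorCoeff_mul hA hQ, ← taylorCoeff_id_mul_succ (hA.fun_mul hQ),
      ← taylorCoeff_congr hev, taylorCoeff_sub hP analyticAt_const, taylorCoeff_const_succ,
      sub_zero]
  have hQ0 : taylorCoeff (fun z => p z + 1) 0 = 2 := by
    rw [taylorCoeff_zero, hp0]; norm_num
  have hQs : ∀ n, taylorCoeff (fun z => p z + 1) (n + 1) = taylorCoeff p (n + 1) := fun n => by
    rw [taylorCoeff_add hP analyticAt_const, taylorCoeff_const_succ, add_zero]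
  have k0 := key 0
  have k1 := key 1
  have k2 := key 2
  have hQ1 := hQs 0
  have hQ2 := hQs 1
  norm_num [Finset.sum_range_succ, taylorCoeff_zero] at k0 k1 k2 hQ1 hQ2
  rw [hp0] at k0 k1 k2
  rw [hQ1] at k1 k2
  rw [hQ2] at k2
  exact ⟨by rw [k0]; ring, by rw [k1]; ring, by rw [k2]; ring⟩

/-- The bound for the Hankel determinant, from the sharp inequality in the Schur parameters. -/
theorem norm_logHankel_le {η : ℝ} (hη : deriv quarticX η = 0) (h₀ : 0.0302 < η) (h₁ : η < 0.0303)
    {f : ℂ → ℂ} (hf : ClassF1 f) : ‖logHankel 2 1 f‖ ≤ quarticX η / 2304 := by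
  obtain ⟨⟨han, hf0, hf1⟩, hre⟩ := hf
  have hp : Caratheodory fun z => (1 - z) * deriv f z :=
    ⟨fun z hz => by have := (han z hz).deriv; fun_prop, by simp [hf1], hre⟩
  obtain ⟨φ, hφ, c1, c2, c3⟩ := hp.exists_schur
  obtain ⟨b, ζ, hb, hζ, d1, d2⟩ := hφ.exists_parameters
  have hH := logHankel_eq (han 0 (Metric.mem_ball_self one_pos)) hf0 hf1 rfl
  have ha := hφ.norm_zero_le
  have hmain := norm_trinomial_add_le (le_quarticX_critical hη h₀) (quarticX_gap hη h₀ h₁) ha hb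
  rw [c3, c2, c1, d2, d1] at hH
  generalize φ 0 = a at *
  have ha' : 0 ≤ 1 - Complex.normSq a := by
    rw [Complex.normSq_eq_norm_sq, sub_nonneg]; exact pow_le_one₀ (norm_nonneg _) ha
  have hb' : 0 ≤ 1 - Complex.normSq b := by
    rw [Complex.normSq_eq_norm_sq, sub_nonneg]; exact pow_le_one₀ (norm_nonneg _) hb
  have hE : 2304 * logHankel 2 1 f = (constC a - (1 - Complex.normSq a : ℝ) * betaC a * b
      - (1 - Complex.normSq a : ℝ) * alphaC a * b ^ 2)
      + 144 * (1 - Complex.normSq a : ℝ) * (1 + 2 * a) * (1 - Complex.normSq b : ℝ) * ζ := by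
    rw [hH, constC, betaC, alphaC]
    push_cast
    rw [Complex.normSq_eq_conj_mul_self]
    ring
  have hζ' : ‖144 * (1 - Complex.normSq a : ℝ) * (1 + 2 * a) * (1 - Complex.normSq b : ℝ) * ζ‖
      ≤ 144 * (1 - Complex.normSq a) * ‖1 + 2 * a‖ * (1 - Complex.normSq b) := by
    rw [norm_mul, norm_mul, norm_mul, norm_mul, Complex.norm_of_nonneg ha',
      Complex.norm_of_nonneg hb']
    norm_num
    exact mul_le_of_le_one_right (by positivity) hζ
  have hn : ‖2304 * logHankel 2 1 f‖ = 2304 * ‖logHankel 2 1 f‖ := by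
    rw [norm_mul]; norm_num
  have := (norm_add_le _ _).trans ((add_le_add_right hζ' _).trans hmain)
  rw [← hE, hn] at this
  linarith

/-! ### The extremal function -/

theorem one_sub_sq_ne_zero {z : ℂ} (hz : z ∈ Metric.ball (0 : ℂ) 1) : 1 - z ^ 2 ≠ 0 := by
  intro h
  have h1 : ‖z‖ < 1 := by simpa using hz
  have h2 : ‖z‖ ^ 2 = 1 := by rw [← norm_pow, ← sub_eq_zero.1 h, norm_one]
  exact absurd h2 (pow_lt_one₀ (norm_nonneg _) h1 two_ne_zero).ne

theorem one_sub_ne_zero_of_mem_ball {z : ℂ} (hz : z ∈ Metric.ball (0 : ℂ) 1) : 1 - z ≠ 0 :=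
  fun h => by simp [← sub_eq_zero.1 h] at hz

theorem caratheodory_pOne {η : ℝ} (hη : |η| < 1) : Caratheodory (pOne η) := by
  refine ⟨fun z hz => ?_, by simp [pOne], fun z hz => ?_⟩
  · have := one_sub_sq_ne_zero hz
    unfold pOne
    fun_prop (disch := assumption)
  · have hD := Complex.normSq_pos.2 (one_sub_sq_ne_zero hz)
    have h1 : ‖z‖ < 1 := by simpa using hz
    have h2 : z.re ^ 2 + z.im ^ 2 < 1 := by
      have := pow_lt_one₀ (norm_nonneg _) h1 two_ne_zero
      rw [← Complex.normSq_eq_norm_sq, Complex.normSq_apply] at this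
      linarith
    have h3 : 0 < 1 + (z.re ^ 2 + z.im ^ 2) + 2 * η * z.re := by
      have := sq_lt_one_iff_abs_lt_one η |>.2 hη
      nlinarith [sq_nonneg (z.re + η), sq_nonneg z.im]
    have h4 : (pOne η z).re = (1 - (z.re ^ 2 + z.im ^ 2)) *
        (1 + (z.re ^ 2 + z.im ^ 2) + 2 * η * z.re) / Complex.normSq (1 - z ^ 2) := by
      rw [pOne, Complex.div_re, ← add_div]
      congr 1
      simp [pow_two]
      ring
    rw [h4]
    exact div_pos (mul_pos (by linarith) h3) hD

/-- The function `extremalF1 η` is the primitive of `pOne η z / (1 - z)` vanishing at `0`. -/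
theorem hasDerivAt_extremalF1 {η : ℝ} (hη : |η| < 1) :
    ∀ z ∈ Metric.ball (0 : ℂ) 1, HasDerivAt (extremalF1 η) (pOne η z / (1 - z)) z := by
  have hd : DifferentiableOn ℂ (fun z => pOne η z / (1 - z)) (Metric.ball 0 1) :=
    (caratheodory_pOne hη).1.differentiableOn.div (by fun_prop)
      fun z hz => one_sub_ne_zero_of_mem_ball hz
  obtain ⟨F, hF0, hF⟩ := hd.isExactOn_ball.with_val_at 0 0
  have heq : ∀ z ∈ Metric.ball (0 : ℂ) 1, extremalF1 η z = F z := by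
    intro z hz
    have hs : ∀ s ∈ Set.uIcc (0 : ℝ) 1, (s : ℂ) * z ∈ Metric.ball (0 : ℂ) 1 := by
      intro s hs
      rw [Set.uIcc_of_le zero_le_one] at hs
      have h1 : ‖z‖ < 1 := by simpa using hz
      rw [mem_ball_zero_iff, norm_mul, Complex.norm_of_nonneg hs.1]
      exact (mul_le_of_le_one_left (norm_nonneg _) hs.2).trans_lt h1
    have hder : ∀ s ∈ Set.uIcc (0 : ℝ) 1, HasDerivAt (fun s : ℝ => F ((s : ℂ) * z))
        (pOne η ((s : ℂ) * z) / (1 - (s : ℂ) * z) * z) s := fun s hs' => by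
      have h1 : HasDerivAt (fun s : ℝ => (s : ℂ) * z) z s := by
        simpa using (Complex.ofRealCLM.hasDerivAt (x := s)).mul_const z
      exact (hF _ (hs s hs')).comp s h1
    have hc : ContinuousOn (fun s : ℝ => pOne η ((s : ℂ) * z) / (1 - (s : ℂ) * z) * z)
        (Set.uIcc 0 1) :=
      (hd.continuousOn.comp (f := fun s : ℝ => (s : ℂ) * z) (by fun_prop) hs).mul
        continuousOn_const
    rw [extremalF1, intervalIntegral.integral_eq_sub_of_hasDerivAt hder hc.intervalIntegrable]
    simp [hF0]
  intro z hz
  exact (hF z hz).congr_of_eventuallyEq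
    (Filter.eventually_of_mem (Metric.isOpen_ball.mem_nhds hz) heq)

theorem one_sub_mul_deriv_extremalF1 {η : ℝ} (hη : |η| < 1) {z : ℂ}
    (hz : z ∈ Metric.ball (0 : ℂ) 1) : (1 - z) * deriv (extremalF1 η) z = pOne η z := by
  rw [(hasDerivAt_extremalF1 hη z hz).deriv, mul_div_cancel₀ _ (one_sub_ne_zero_of_mem_ball hz)]

theorem classF1_extremalF1 {η : ℝ} (hη : |η| < 1) : ClassF1 (extremalF1 η) := by
  have hd : DifferentiableOn ℂ (extremalF1 η) (Metric.ball 0 1) := fun z hz =>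
    (hasDerivAt_extremalF1 hη z hz).differentiableAt.differentiableWithinAt
  refine ⟨⟨hd.analyticOnNhd Metric.isOpen_ball, by simp [extremalF1], ?_⟩, fun z hz => ?_⟩
  · rw [(hasDerivAt_extremalF1 hη 0 (Metric.mem_ball_self one_pos)).deriv]
    simp [pOne]
  · rw [one_sub_mul_deriv_extremalF1 hη hz]
    exact (caratheodory_pOne hη).2.2 z hz

/-- The coefficients of `pOne η` follow from `pOne η z - 1 = z (2 η + z (1 + pOne η z))`. -/
theorem taylorCoeff_pOne {η : ℝ} (hη : |η| < 1) :
    taylorCoeff (pOne η) 1 = 2 * η ∧ taylorCoeff (pOne η) 2 = 2 ∧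
      taylorCoeff (pOne η) 3 = 2 * η := by
  obtain ⟨han, h0, -⟩ := caratheodory_pOne hη
  have hA : AnalyticAt ℂ (pOne η) 0 := han 0 (Metric.mem_ball_self one_pos)
  have hB : AnalyticAt ℂ (fun z => 1 + pOne η z) 0 := by fun_prop
  have hC : AnalyticAt ℂ (fun z => z * (1 + pOne η z)) 0 := by fun_prop
  have hD : AnalyticAt ℂ (fun z => 2 * (η : ℂ) + z * (1 + pOne η z)) 0 := by fun_prop
  have hev : (fun z => pOne η z - 1) =ᶠ[nhds 0]
      fun z => z * (2 * (η : ℂ) + z * (1 + pOne η z)) := by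
    filter_upwards [Metric.ball_mem_nhds (0 : ℂ) one_pos] with z hz
    have := one_sub_sq_ne_zero hz
    rw [pOne]
    field_simp
    ring
  have key : ∀ n, taylorCoeff (pOne η) (n + 1)
      = taylorCoeff (fun z => 2 * (η : ℂ) + z * (1 + pOne η z)) n := fun n => by
    rw [← taylorCoeff_id_mul_succ hD, ← taylorCoeff_congr hev, taylorCoeff_sub hA analyticAt_const,
      taylorCoeff_const_succ, sub_zero]
  have key' : ∀ n, taylorCoeff (pOne η) (n + 2) = taylorCoeff (fun z => 1 + pOne η z) n :=
    fun n => by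
      rw [key, taylorCoeff_add analyticAt_const hC, taylorCoeff_const_succ, zero_add,
        taylorCoeff_id_mul_succ hB]
  have k1 : taylorCoeff (pOne η) 1 = 2 * η := by rw [key 0, taylorCoeff_zero]; simp
  refine ⟨k1, ?_, ?_⟩
  · rw [key' 0, taylorCoeff_zero, h0]; norm_num
  · rw [key' 1, taylorCoeff_add analyticAt_const hA, taylorCoeff_const_succ, k1, zero_add]

theorem logHankel_extremalF1 {η : ℝ} (hη : |η| < 1) :
    logHankel 2 1 (extremalF1 η) = -((quarticX η / 2304 : ℝ) : ℂ) := by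
  have h0 : (0 : ℂ) ∈ Metric.ball (0 : ℂ) 1 := Metric.mem_ball_self one_pos
  obtain ⟨⟨han, hf0, hf1⟩, -⟩ := classF1_extremalF1 hη
  obtain ⟨c1, c2, c3⟩ := taylorCoeff_pOne hη
  have hc : ∀ n, taylorCoeff (fun z => (1 - z) * deriv (extremalF1 η) z) n
      = taylorCoeff (pOne η) n := taylorCoeff_congr <|
    Filter.eventually_of_mem (Metric.isOpen_ball.mem_nhds h0)
      fun z hz => one_sub_mul_deriv_extremalF1 hη hz
  have hH := logHankel_eq (han 0 h0) hf0 hf1 rfl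
  rw [hc, hc, hc, c1, c2, c3] at hH
  rw [quarticX]
  push_cast
  linear_combination hH / 2304

theorem theorem2p3 :
    ∃ η : ℝ,
      (∀ x : ℝ, deriv quarticX x = 0 ↔ x = η) ∧
      0.0302 < η ∧ η < 0.0303 ∧
      |2 * η - 0.0605378| < 5e-8 ∧
      (∀ f : ℂ → ℂ, ClassF1 f → ‖logHankel 2 1 f‖ ≤ quarticX η / 2304) ∧
      Caratheodory (pOne η) ∧
      ClassF1 (extremalF1 η) ∧
      ‖logHankel 2 1 (extremalF1 η)‖ = quarticX η / 2304 := by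
  obtain ⟨η, hη, hl, hr⟩ := exists_critical_point
  have h₀ : 0.0302 < η := by linarith
  have h₁ : η < 0.0303 := by linarith
  have habs : |η| < 1 := abs_lt.2 ⟨by linarith, by linarith⟩
  have hcrit : deriv quarticX η = 0 := (hη η).2 rfl
  refine ⟨η, hη, h₀, h₁, abs_lt.2 ⟨by linarith, by linarith⟩,
    fun f hf => norm_logHankel_le hcrit h₀ h₁ hf, caratheodory_pOne habs,
    classF1_extremalF1 habs, ?_⟩
  have hpos : 0 ≤ quarticX η / 2304 :=
    div_nonneg (le_trans (by norm_num) (le_quarticX_critical hcrit h₀)) (by norm_num)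
  rw [logHankel_extremalF1 habs, norm_neg, Complex.norm_of_nonneg hpos]
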